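/- For a real $m\times n$ matrix $M$ write $p(M)=\frac1{mn}\sum_{i,j}M(i,j)$ for the average of its entries. A submatrix is given by an arbitrary set of rows and an arbitrary set of columns; it has size at least $a\times b$ if it has at least $a$ rows and at least $b$ columns. Call $M$ admissible if all its entries are nonnegative and none of them lies in the open interval $(0,1)$. (For $r=0$ we read $\log r=0$ and $\kappa(\log r)^2/r=0$.) (1) There is an absolute constant $C>0$ such that every admissible $m\times n$ matrix $M$ of rank $r$ with $p(M)=\varepsilon\le 1/2$ contains an all-zero submatrix of size at least $$m\,2^{-C(\log r+\sqrt{\varepsilon r})}\times n\,2^{-C(\log r+\sqrt{\varepsilon r})}.$$ (2) This is optimal for $\varepsilon\gg(\log r)^2/r$, in the following sense. (a) For every $\kappa>0$ there is $C_\kappa>0$ such that every admissible $m\times n$ matrix $M$ of rank $r$ with $\kappa(\log r)^2/r\le p(M)=\varepsilon\le 1/2$ contains an all-zero submatrix of size at least $m\,2^{-C_\kappa\sqrt{\varepsilon r}}\times n\,2^{-C_\kappa\sqrt{\varepsilon r}}$. (b) Conversely, for every integer $r\ge1$, every real $\varepsilon$ with $1/r\le\varepsilon\le 1/2$ and every $N$,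 there are $n\ge N$ and an admissible $n\times n$ matrix $M$ of rank exactly $r$ with $p(M)=\varepsilon$ such that every all-zero square submatrix of $M$ has at most $n\,2^{-\lfloor\sqrt{\varepsilon r}\rfloor}$ rows (note that $\lfloor\sqrt{\varepsilon r}\rfloor\ge\frac12\sqrt{\varepsilon r}$, and that $\varepsilon \ge \kappa(\log r)^2/r$ implies $\varepsilon\ge 1/r$ once $r$ is large in terms of $\kappa$). (3) (The Sudakov--Tomon log-rank bound.) There is an absolute constant $C>0$ such that every $m\times n$ matrix of rank $r$ with all entries in $\{0,1\}$ contains a constant submatrix of size at least $m\,2^{-C\sqrt r}\times n\,2^{-C\sqrt r}$. -/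

import Mathlib

/-- The average `p(M) = (1 / (m n)) ∑ M(i,j)` of the entries of a real matrix. -/
noncomputable def avgEntry {m n : ℕ} (M : Matrix (Fin m) (Fin n) ℝ) : ℝ :=
  (∑ i, ∑ j, M i j) / ((m : ℝ) * (n : ℝ))

/-- All entries are nonnegative and none of them lies in the open interval `(0, 1)`. -/
def IsNonnegSeparated {m n : ℕ} (M : Matrix (Fin m) (Fin n) ℝ) : Prop :=
  ∀ i j, 0 ≤ M i j ∧ M i j ∉ Set.Ioo (0 : ℝ) 1

/-- `M` has a submatrix, on a set `R` of rows and a set `S` of columns (not necessarily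
consecutive), with at least `a` rows and at least `b` columns, all of whose entries are `v`. -/
def HasSubmatrixEqual {m n : ℕ} (M : Matrix (Fin m) (Fin n) ℝ) (v a b : ℝ) : Prop :=
  ∃ (R : Finset (Fin m)) (S : Finset (Fin n)),
    a ≤ (R.card : ℝ) ∧ b ≤ (S.card : ℝ) ∧ ∀ i ∈ R, ∀ j ∈ S, M i j = v

/-- `M` has an all-zero submatrix of size at least `a × b`. -/
def HasZeroSubmatrix {m n : ℕ} (M : Matrix (Fin m) (Fin n) ℝ) (a b : ℝ) : Prop :=
  HasSubmatrixEqual M 0 a b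

/-- `M` has a constant (monochromatic) submatrix of size at least `a × b`. -/
def HasConstantSubmatrix {m n : ℕ} (M : Matrix (Fin m) (Fin n) ℝ) (a b : ℝ) : Prop :=
  ∃ v : ℝ, HasSubmatrixEqual M v a b

/-!
The upper bounds hold in a stronger form: a matrix `M` of rank `r` and average `ε ≤ 1/2`, with
entries in `{0} ∪ [1, ∞)`, has an all-zero submatrix on a `2 ^ (-C √(ε r))` part of the rows and of
the columns, with no logarithmic loss (`hasZeroSubmatrix_two_rpow`). The bound for binary matrices
follows, since `M` or its complement has average at most `1/2`.

The proof is a density decrement for nonnegative weights on the rows and columns. The heart is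
`exists_weights_density_le`: if the weighted average is `ε`, then on weights that lose at most a
factor `3` it is at most `2ε/3` or `ε - c √(ε / r)`. So `√(ε r)` drops by a constant in each round,
and after `O(√(ε r))` rounds the density is below `1 / (4 r)`. At that point the sparse rows are
spanned by at most `r` of them, whose common zeros fill half of the columns
(`exists_zero_submatrix_of_density_le`).

For the decrement, a signed sum `∑ μᵢ νⱼ (Mᵢⱼ - ε) xᵢ yⱼ` with `|xᵢ|, |yⱼ| ≤ 1` which is large yields
sparser weights (`exists_weights_of_discrepancy`). By Grothendieck's inequality, `xᵢ` and `yⱼ` may be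
taken in the unit ball of a Hilbert space. With `E = M - ε`, whose rows span a space `V` of dimension
at most `r + 1`, let `xᵢ` be the normalized `i`-th row of `E` in `L²(w)` and `yⱼ` the normalized
reproducing kernel of `V` at `j`, so that `⟨xᵢ, yⱼ⟩ = Eᵢⱼ / (‖Eᵢ‖ kⱼ)`, where `k` is the Christoffel
function of `V`. The weight `w` has to be flat: comparable to `νⱼ min(1, A / kⱼ)` with
`A ≍ √(r / ν(κ))`. It is obtained by iterating this expression, which is monotone and homogeneous of
degree at most `1/2` in `w` (`exists_flat_weight`); as `∑ wⱼ kⱼ² ≤ dim V`, only few columns are damped. The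
signed sum is then at least of order `A⁻¹ ∑ μᵢ ‖Eᵢ‖`, and `‖Eᵢ‖² ≳ ε ν(κ)` for every row of `M`
of density at least `ε / 2`; if most of the mass is on sparser rows, one restricts to these.

For the optimality, let the rows and columns be indexed by words of length `t = ⌊√(ε r)⌋` over
alphabets of about `t / ε` letters, and let the entries be proportional to the number of agreements
of two words. In an all-zero submatrix the rows and the columns use disjoint sets of letters in each
coordinate, so by the AM-GM inequality the number of rows times the number of columns is at most
`4 ^ (-t)` of the total (`four_pow_mul_card_mul_card_le`).
-/

/-! ### Grothendieck's inequality -/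

/-- The signed sum `∑ₖ ± xₖ`, the signs being given by `ω`. -/
def signSum {d : ℕ} (x : Fin d → ℝ) (ω : Fin d → Bool) : ℝ :=
  ∑ k, (if ω k then x k else -x k)

theorem signSum_cons {d : ℕ} (x : Fin (d + 1) → ℝ) (b : Bool) (ω : Fin d → Bool) :
    signSum x (Fin.cons b ω : Fin (d + 1) → Bool)
      = (if b then x 0 else -x 0) + signSum (fun k => x k.succ) ω := by
  simp [signSum, Fin.sum_univ_succ]

theorem sum_bool_cons {d : ℕ} (f : (Fin (d + 1) → Bool) → ℝ) :
    ∑ ω, f ω = ∑ ω : Fin d → Bool, (f (Fin.cons true ω) + f (Fin.cons false ω)) := by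
  rw [← (Fin.consEquiv (fun _ => Bool)).sum_comp, Fintype.sum_prod_type, Finset.sum_comm]
  simp [Fin.consEquiv]

theorem sum_signSum_mul {d : ℕ} (x y : Fin d → ℝ) :
    ∑ ω, signSum x ω * signSum y ω = 2 ^ d * ∑ k, x k * y k := by
  induction d with
  | zero => simp [signSum]
  | succ d ih =>
    rw [sum_bool_cons, Fin.sum_univ_succ]
    simp only [signSum_cons, if_true, Bool.false_eq_true, if_false]
    have h := ih (fun k => x k.succ) (fun k => y k.succ)
    calc _ = ∑ ω : Fin d → Bool, (2 * (x 0 * y 0)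
            + 2 * (signSum (fun k => x k.succ) ω * signSum (fun k => y k.succ) ω)) :=
          Finset.sum_congr rfl fun ω _ => by ring
      _ = _ := by
          rw [Finset.sum_add_distrib, ← Finset.mul_sum (a := (2 : ℝ))
            (f := fun ω => signSum (fun k => x k.succ) ω * signSum (fun k => y k.succ) ω), h]
          simp
          ring

theorem sum_signSum_pow_four_le {d : ℕ} (x : Fin d → ℝ) :
    ∑ ω, signSum x ω ^ 4 ≤ 3 * 2 ^ d * (∑ k, x k ^ 2) ^ 2 := by
  induction d with
  | zero => simp [signSum]
  | succ d ih =>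
    rw [sum_bool_cons, Fin.sum_univ_succ]
    simp only [signSum_cons, if_true, Bool.false_eq_true, if_false]
    have h4 := ih (fun k => x k.succ)
    have h2 := sum_signSum_mul (fun k => x k.succ) (fun k => x k.succ)
    simp only [← pow_two] at h2
    set s := ∑ k : Fin d, x k.succ ^ 2
    calc _ = ∑ ω : Fin d → Bool, (2 * x 0 ^ 4 + 12 * x 0 ^ 2 * signSum (fun k => x k.succ) ω ^ 2
            + 2 * signSum (fun k => x k.succ) ω ^ 4) :=
          Finset.sum_congr rfl fun ω _ => by ring
      _ = 2 ^ d * (2 * x 0 ^ 4) + 12 * x 0 ^ 2 * (2 ^ d * s)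
            + 2 * ∑ ω : Fin d → Bool, signSum (fun k => x k.succ) ω ^ 4 := by
          simp only [Finset.sum_add_distrib, ← Finset.mul_sum, h2]
          simp
          ring
      _ ≤ 2 ^ d * (2 * x 0 ^ 4) + 12 * x 0 ^ 2 * (2 ^ d * s) + 2 * (3 * 2 ^ d * s ^ 2) := by gcongr
      _ ≤ _ := by
          have : 0 ≤ (2 : ℝ) ^ d * x 0 ^ 4 := by positivity
          rw [pow_succ (2 : ℝ) d]
          nlinarith

/-- Truncation of a real number to `[-2, 2]`. -/
def clampTwo (t : ℝ) : ℝ := max (-2) (min 2 t)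

theorem abs_clampTwo_le (t : ℝ) : |clampTwo t| ≤ 2 := by
  unfold clampTwo
  rw [abs_le]
  exact ⟨le_max_left _ _, max_le (by norm_num) (min_le_left _ _)⟩

theorem clampTwo_sq_le (t : ℝ) : clampTwo t ^ 2 ≤ t ^ 2 := by
  unfold clampTwo
  rcases le_total 2 t with h | h
  · rw [min_eq_left h, max_eq_right (by norm_num)]; nlinarith
  · rw [min_eq_right h]
    rcases le_total (-2) t with h' | h'
    · rw [max_eq_right h']
    · rw [max_eq_left h']; nlinarith

theorem sub_clampTwo_sq_le (t : ℝ) : (t - clampTwo t) ^ 2 ≤ t ^ 4 / 64 := by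
  have key : |t - clampTwo t| ≤ t ^ 2 / 8 := by
    unfold clampTwo
    rcases le_total 2 t with h | h
    · rw [min_eq_left h, max_eq_right (by norm_num), abs_of_nonneg (by linarith)]
      nlinarith [sq_nonneg (t - 4)]
    · rw [min_eq_right h]
      rcases le_total (-2) t with h' | h'
      · rw [max_eq_right h', sub_self, abs_zero]; positivity
      · rw [max_eq_left h', abs_of_nonpos (by linarith)]
        nlinarith [sq_nonneg (t + 4)]
  calc (t - clampTwo t) ^ 2 = |t - clampTwo t| ^ 2 := (sq_abs _).symm
    _ ≤ (t ^ 2 / 8) ^ 2 := by gcongr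
    _ = _ := by ring

section Grothendieck

variable {ι κ : Type*} [Fintype ι] [Fintype κ]

/-- The values of `∑ β i j ⟨xᵢ, yⱼ⟩` over all vectors `xᵢ, yⱼ` of the Euclidean unit balls of
arbitrary finite dimension. -/
def hilbertValues (β : ι → κ → ℝ) : Set ℝ :=
  {v | ∃ (d : ℕ) (x : ι → Fin d → ℝ) (y : κ → Fin d → ℝ),
    (∀ i, ∑ k, x i k ^ 2 ≤ 1) ∧ (∀ j, ∑ k, y j k ^ 2 ≤ 1) ∧
      v = ∑ i, ∑ j, β i j * ∑ k, x i k * y j k}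

theorem hilbertValues_nonempty (β : ι → κ → ℝ) : (hilbertValues β).Nonempty :=
  ⟨0, 0, 0, 0, by simp, by simp, by simp⟩

theorem bddAbove_hilbertValues (β : ι → κ → ℝ) : BddAbove (hilbertValues β) := by
  refine ⟨∑ i, ∑ j, |β i j|, ?_⟩
  rintro v ⟨d, x, y, hx, hy, rfl⟩
  refine Finset.sum_le_sum fun i _ => Finset.sum_le_sum fun j _ => ?_
  have h : |∑ k, x i k * y j k| ≤ 1 := by
    refine abs_le_one_iff_mul_self_le_one.2 ?_
    have := Finset.sum_mul_sq_le_sq_mul_sq Finset.univ (x i) (y j)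
    have h0 : 0 ≤ ∑ k, y j k ^ 2 := Finset.sum_nonneg fun _ _ => sq_nonneg _
    nlinarith [hx i, hy j]
  calc _ ≤ |β i j * ∑ k, x i k * y j k| := le_abs_self _
    _ = |β i j| * |∑ k, x i k * y j k| := abs_mul _ _
    _ ≤ |β i j| * 1 := by gcongr
    _ = _ := mul_one _

theorem sum_inner_le_sSup_hilbertValues (β : ι → κ → ℝ) {α : Type*} [Fintype α]
    (x : ι → α → ℝ) (y : κ → α → ℝ) {a b : ℝ} (ha : 0 < a) (hb : 0 < b)
    (hx : ∀ i, ∑ k, x i k ^ 2 ≤ a ^ 2) (hy : ∀ j, ∑ k, y j k ^ 2 ≤ b ^ 2) :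
    ∑ i, ∑ j, β i j * ∑ k, x i k * y j k ≤ a * b * sSup (hilbertValues β) := by
  let e := Fintype.equivFin α
  have hmem : (∑ i, ∑ j, β i j * ∑ k, x i k * y j k) / (a * b) ∈ hilbertValues β := by
    refine ⟨Fintype.card α, fun i k => x i (e.symm k) / a, fun j k => y j (e.symm k) / b,
      fun i => ?_, fun j => ?_, ?_⟩
    · rw [e.symm.sum_comp (fun k => (x i k / a) ^ 2)]
      simp only [div_pow]
      rw [← Finset.sum_div, div_le_one (by positivity)]
      exact hx i
    · rw [e.symm.sum_comp (fun k => (y j k / b) ^ 2)]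
      simp only [div_pow]
      rw [← Finset.sum_div, div_le_one (by positivity)]
      exact hy j
    · rw [Finset.sum_div]
      refine Finset.sum_congr rfl fun i _ => ?_
      rw [Finset.sum_div]
      refine Finset.sum_congr rfl fun j _ => ?_
      rw [e.symm.sum_comp (fun k => x i k / a * (y j k / b)), mul_div_assoc, Finset.sum_div]
      congr 1
      exact Finset.sum_congr rfl fun k _ => by rw [div_mul_div_comm]
  have := le_csSup (bddAbove_hilbertValues β) hmem
  rw [div_le_iff₀ (by positivity)] at this
  linarith

/-- **Grothendieck's inequality**, with constant `8`. Vectors are replaced by their Rademacher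
sums, truncated at `2`; the truncation error is again a Hilbert space value, at most half of the
supremum, and is absorbed. -/
theorem grothendieck_inequality (β : ι → κ → ℝ) {D : ℝ}
    (hD : ∀ (x : ι → ℝ) (y : κ → ℝ), (∀ i, |x i| ≤ 1) → (∀ j, |y j| ≤ 1) →
      ∑ i, ∑ j, β i j * (x i * y j) ≤ D)
    {α : Type*} [Fintype α] (x : ι → α → ℝ) (y : κ → α → ℝ)
    (hx : ∀ i, ∑ k, x i k ^ 2 ≤ 1) (hy : ∀ j, ∑ k, y j k ^ 2 ≤ 1) :
    ∑ i, ∑ j, β i j * ∑ k, x i k * y j k ≤ 8 * D := by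
  set G := sSup (hilbertValues β) with hG
  have hGD : G ≤ 4 * D + G / 2 := by
    refine csSup_le (hilbertValues_nonempty β) ?_
    rintro v ⟨d, x, y, hx, hy, rfl⟩
    have hpos : (0 : ℝ) < 2 ^ d := by positivity
    have hs : √((2 : ℝ) ^ d) ^ 2 = 2 ^ d := Real.sq_sqrt hpos.le
    have hs0 : 0 < √((2 : ℝ) ^ d) := Real.sqrt_pos.2 hpos
    have hL2 : ∀ z : Fin d → ℝ, ∑ k, z k ^ 2 ≤ 1 → ∑ ω, signSum z ω ^ 2 ≤ √((2 : ℝ) ^ d) ^ 2 := by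
      intro z hz
      have := sum_signSum_mul z z
      simp only [← pow_two] at this
      rw [this, hs]
      nlinarith
    have hclamp : ∀ z : Fin d → ℝ, ∑ k, z k ^ 2 ≤ 1 →
        ∑ ω, clampTwo (signSum z ω) ^ 2 ≤ √((2 : ℝ) ^ d) ^ 2 := fun z hz =>
      (Finset.sum_le_sum fun ω _ => clampTwo_sq_le _).trans (hL2 z hz)
    have htail : ∀ z : Fin d → ℝ, ∑ k, z k ^ 2 ≤ 1 →
        ∑ ω, (signSum z ω - clampTwo (signSum z ω)) ^ 2 ≤ (√((2 : ℝ) ^ d) / 4) ^ 2 := by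
      intro z hz
      have h0 : 0 ≤ ∑ k, z k ^ 2 := Finset.sum_nonneg fun _ _ => sq_nonneg _
      have h1 : (∑ k, z k ^ 2) ^ 2 ≤ 1 := pow_le_one₀ h0 hz
      calc _ ≤ ∑ ω, signSum z ω ^ 4 / 64 := Finset.sum_le_sum fun ω _ => sub_clampTwo_sq_le _
        _ = (∑ ω, signSum z ω ^ 4) / 64 := by rw [Finset.sum_div]
        _ ≤ (3 * 2 ^ d * (∑ k, z k ^ 2) ^ 2) / 64 := by gcongr; exact sum_signSum_pow_four_le z
        _ ≤ _ := by rw [div_pow, hs]; nlinarith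
    have hmain : ∑ i, ∑ j, β i j * ∑ ω, clampTwo (signSum (x i) ω) * clampTwo (signSum (y j) ω)
        ≤ 2 ^ d * (4 * D) := by
      have hω : ∀ ω : Fin d → Bool,
          ∑ i, ∑ j, β i j * (clampTwo (signSum (x i) ω) * clampTwo (signSum (y j) ω)) ≤ 4 * D := by
        intro ω
        have := hD (fun i => clampTwo (signSum (x i) ω) / 2)
          (fun j => clampTwo (signSum (y j) ω) / 2)
          (fun i => by
            rw [abs_div, abs_two, div_le_one two_pos]; exact abs_clampTwo_le _)
          (fun j => by
            rw [abs_div, abs_two, div_le_one two_pos]; exact abs_clampTwo_le _)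
        calc _ = 4 * ∑ i, ∑ j, β i j *
              (clampTwo (signSum (x i) ω) / 2 * (clampTwo (signSum (y j) ω) / 2)) := by
              simp only [Finset.mul_sum]
              exact Finset.sum_congr rfl fun i _ => Finset.sum_congr rfl fun j _ => by ring
          _ ≤ _ := by linarith
      calc _ = ∑ ω, ∑ i, ∑ j,
            β i j * (clampTwo (signSum (x i) ω) * clampTwo (signSum (y j) ω)) := by
            simp only [Finset.mul_sum]
            rw [Finset.sum_comm]
            refine Eq.trans ?_ Finset.sum_comm
            rw [Finset.sum_comm]
            exact Finset.sum_congr rfl fun i _ => Finset.sum_comm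
        _ ≤ ∑ _ω : Fin d → Bool, 4 * D := Finset.sum_le_sum fun ω _ => hω ω
        _ = _ := by simp
    have h2 := sum_inner_le_sSup_hilbertValues β
      (fun i ω => signSum (x i) ω - clampTwo (signSum (x i) ω)) (fun j ω => signSum (y j) ω)
      (a := √((2 : ℝ) ^ d) / 4) (b := √((2 : ℝ) ^ d)) (by positivity) hs0
      (fun i => htail _ (hx i)) (fun j => hL2 _ (hy j))
    have h3 := sum_inner_le_sSup_hilbertValues β
      (fun i ω => clampTwo (signSum (x i) ω))
      (fun j ω => signSum (y j) ω - clampTwo (signSum (y j) ω))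
      (a := √((2 : ℝ) ^ d)) (b := √((2 : ℝ) ^ d) / 4) hs0 (by positivity)
      (fun i => hclamp _ (hx i)) (fun j => htail _ (hy j))
    have hsplit : 2 ^ d * ∑ i, ∑ j, β i j * ∑ k, x i k * y j k
        = (∑ i, ∑ j, β i j * ∑ ω, clampTwo (signSum (x i) ω) * clampTwo (signSum (y j) ω))
        + (∑ i, ∑ j, β i j *
            ∑ ω, (signSum (x i) ω - clampTwo (signSum (x i) ω)) * signSum (y j) ω)
        + ∑ i, ∑ j, β i j *
            ∑ ω, clampTwo (signSum (x i) ω) * (signSum (y j) ω - clampTwo (signSum (y j) ω)) := by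
      simp only [← Finset.sum_add_distrib, Finset.mul_sum (a := (2 : ℝ) ^ d)]
      refine Finset.sum_congr rfl fun i _ => Finset.sum_congr rfl fun j _ => ?_
      rw [← mul_add, ← mul_add, ← Finset.sum_add_distrib, ← Finset.sum_add_distrib,
        mul_left_comm, ← sum_signSum_mul]
      congr 1
      exact Finset.sum_congr rfl fun ω _ => by ring
    have hss : √((2 : ℝ) ^ d) * √((2 : ℝ) ^ d) = 2 ^ d := Real.mul_self_sqrt hpos.le
    have e1 : √((2 : ℝ) ^ d) / 4 * √((2 : ℝ) ^ d) * G = 2 ^ d * (G / 4) := by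
      linear_combination (G / 4) * hss
    have e2 : √((2 : ℝ) ^ d) * (√((2 : ℝ) ^ d) / 4) * G = 2 ^ d * (G / 4) := by
      linear_combination (G / 4) * hss
    rw [← hG, e1] at h2
    rw [← hG, e2] at h3
    refine le_of_mul_le_mul_left ?_ hpos
    rw [hsplit]
    calc _ ≤ 2 ^ d * (4 * D) + 2 ^ d * (G / 4) + 2 ^ d * (G / 4) := by gcongr
      _ = _ := by ring
  have := sum_inner_le_sSup_hilbertValues β x y one_pos one_pos (by simpa using hx)
    (by simpa using hy)
  rw [one_mul, one_mul, ← hG] at this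
  linarith

end Grothendieck

/-! ### Christoffel functions of a space of functions and flattened weights -/

section Christoffel

open scoped InnerProductSpace

variable {κ : Type*}

/-- The isometric embedding `f ↦ (√(w j) f j)ⱼ` of the weighted space `L²(w)` into Euclidean
space. -/
noncomputable def weightedEmb (w : κ → ℝ) : (κ → ℝ) →ₗ[ℝ] EuclideanSpace ℝ κ where
  toFun f := WithLp.toLp 2 fun j => √(w j) * f j
  map_add' f g := by ext j; simp [mul_add]
  map_smul' c f := by ext j; simp [mul_left_comm]

@[simp] theorem weightedEmb_apply (w f : κ → ℝ) (j : κ) :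
    weightedEmb w f j = √(w j) * f j := rfl

variable [Fintype κ]

theorem norm_weightedEmb_sq {w : κ → ℝ} (hw : ∀ j, 0 ≤ w j) (f : κ → ℝ) :
    ‖weightedEmb w f‖ ^ 2 = ∑ j, w j * f j ^ 2 := by
  rw [EuclideanSpace.norm_sq_eq]
  refine Finset.sum_congr rfl fun j _ => ?_
  rw [weightedEmb_apply, Real.norm_eq_abs, sq_abs, mul_pow, Real.sq_sqrt (hw j)]

/-- The point evaluation at `j`, as an element of the image of `V` in `L²(w)`. Up to the factor
`√(w j)` it is the reproducing kernel of `V` at `j`. -/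
noncomputable def repKernel [DecidableEq κ] (V : Submodule ℝ (κ → ℝ)) (w : κ → ℝ) (j : κ) :
    EuclideanSpace ℝ κ :=
  (V.map (weightedEmb w)).starProjection (EuclideanSpace.single j 1)

/-- The Christoffel function of `V` at `j`: the norm of the evaluation `f ↦ f j` on `V ⊆ L²(w)`.
It has the junk value `0` where `w j = 0`. -/
noncomputable def christoffel [DecidableEq κ] (V : Submodule ℝ (κ → ℝ)) (w : κ → ℝ) (j : κ) : ℝ :=
  ‖repKernel V w j‖ / √(w j)

variable [DecidableEq κ] {V : Submodule ℝ (κ → ℝ)}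

theorem christoffel_nonneg (V : Submodule ℝ (κ → ℝ)) (w : κ → ℝ) (j : κ) :
    0 ≤ christoffel V w j := by
  unfold christoffel; positivity

theorem inner_weightedEmb_repKernel (w : κ → ℝ) {f : κ → ℝ} (hf : f ∈ V) (j : κ) :
    ⟪weightedEmb w f, repKernel V w j⟫_ℝ = √(w j) * f j := by
  have hmem : weightedEmb w f ∈ V.map (weightedEmb w) := Submodule.mem_map_of_mem hf
  rw [repKernel, ← Submodule.inner_starProjection_left_eq_right,
    Submodule.starProjection_eq_self_iff.2 hmem, EuclideanSpace.inner_single_right]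
  simp

theorem abs_le_christoffel_mul_norm {w : κ → ℝ} {j : κ} (hj : 0 < w j) {f : κ → ℝ} (hf : f ∈ V) :
    |f j| ≤ christoffel V w j * ‖weightedEmb w f‖ := by
  have h := abs_real_inner_le_norm (weightedEmb w f) (repKernel V w j)
  have hs : 0 < √(w j) := Real.sqrt_pos.2 hj
  rw [inner_weightedEmb_repKernel w hf, abs_mul, abs_of_pos hs] at h
  rw [christoffel, div_mul_eq_mul_div, le_div_iff₀ hs]
  linarith

theorem christoffel_le {w : κ → ℝ} {j : κ} (hj : 0 < w j) {C : ℝ} (hC : 0 ≤ C)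
    (h : ∀ f ∈ V, |f j| ≤ C * ‖weightedEmb w f‖) : christoffel V w j ≤ C := by
  have hs : 0 < √(w j) := Real.sqrt_pos.2 hj
  obtain ⟨f, hf, hfe⟩ := Submodule.mem_map.1
    (Submodule.starProjection_apply_mem (V.map (weightedEmb w)) (EuclideanSpace.single j (1 : ℝ)))
  change weightedEmb w f = repKernel V w j at hfe
  have h1 := inner_weightedEmb_repKernel w hf j
  rw [hfe, real_inner_self_eq_norm_sq] at h1
  have h2 := h f hf
  rw [hfe] at h2
  rw [christoffel, div_le_iff₀ hs]
  rcases (norm_nonneg (repKernel V w j)).eq_or_lt with h0 | h0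
  · rw [← h0]; positivity
  · refine le_of_mul_le_mul_right ?_ h0
    rw [← pow_two, h1]
    calc √(w j) * f j ≤ √(w j) * |f j| := by gcongr; exact le_abs_self _
      _ ≤ √(w j) * (C * ‖repKernel V w j‖) := by gcongr
      _ = _ := by ring

/-- The evaluation norm decreases as the weight grows, and is homogeneous of degree `-1/2`. -/
theorem christoffel_le_div_sqrt {w w' : κ → ℝ} {c : ℝ} (hc : 0 < c) (hw : ∀ j, 0 ≤ w j)
    (hww' : ∀ j, c * w j ≤ w' j) {j : κ} (hj : 0 < w j) :
    christoffel V w' j ≤ christoffel V w j / √c := by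
  have hsc : 0 < √c := Real.sqrt_pos.2 hc
  have hw' : ∀ j, 0 ≤ w' j := fun j => (mul_nonneg hc.le (hw j)).trans (hww' j)
  refine christoffel_le (lt_of_lt_of_le (mul_pos hc hj) (hww' j))
    (div_nonneg (christoffel_nonneg _ _ _) hsc.le) fun f hf => ?_
  refine (abs_le_christoffel_mul_norm hj hf).trans ?_
  rw [div_mul_eq_mul_div, le_div_iff₀ hsc, mul_assoc]
  refine mul_le_mul_of_nonneg_left ?_ (christoffel_nonneg _ _ _)
  refine le_of_sq_le_sq ?_ (norm_nonneg _)
  rw [mul_pow, Real.sq_sqrt hc.le, norm_weightedEmb_sq hw, norm_weightedEmb_sq hw',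
    Finset.sum_mul]
  refine Finset.sum_le_sum fun k _ => ?_
  calc w k * f k ^ 2 * c = (c * w k) * f k ^ 2 := by ring
    _ ≤ _ := by gcongr; exact hww' k

theorem sum_norm_repKernel_sq_le (V : Submodule ℝ (κ → ℝ)) (w : κ → ℝ) :
    ∑ j, ‖repKernel V w j‖ ^ 2 ≤ Module.finrank ℝ V := by
  set W := V.map (weightedEmb w) with hW
  let b := stdOrthonormalBasis ℝ W
  have h : ∀ j, ‖repKernel V w j‖ ^ 2
      = ∑ a, ⟪EuclideanSpace.single j (1 : ℝ), (b a : EuclideanSpace ℝ κ)⟫_ℝ ^ 2 := by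
    intro j
    have h1 := b.sum_sq_inner_left (W.orthogonalProjectionOnto (EuclideanSpace.single j (1 : ℝ)))
    rw [repKernel, Submodule.starProjection_apply, ← Submodule.coe_norm, ← h1]
    refine Finset.sum_congr rfl fun a _ => ?_
    rw [Submodule.inner_orthogonalProjectionOnto_eq_of_mem_right]
  simp only [h]
  rw [Finset.sum_comm]
  have h1 : ∀ a, ∑ j, ⟪EuclideanSpace.single j (1 : ℝ), (b a : EuclideanSpace ℝ κ)⟫_ℝ ^ 2 = 1 := by
    intro a
    have h2 : ‖(b a : EuclideanSpace ℝ κ)‖ = 1 := by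
      rw [← Submodule.coe_norm]; exact b.orthonormal.1 a
    refine Eq.trans ?_ (show ‖(b a : EuclideanSpace ℝ κ)‖ ^ 2 = 1 by rw [h2, one_pow])
    rw [EuclideanSpace.norm_sq_eq]
    refine Finset.sum_congr rfl fun j _ => ?_
    rw [EuclideanSpace.inner_single_left]
    simp
  simp only [h1]
  simp only [Finset.sum_const, Finset.card_univ, Fintype.card_fin, nsmul_eq_mul, mul_one]
  exact_mod_cast Submodule.finrank_map_le _ _

theorem mul_christoffel_sq_le {w : κ → ℝ} (hw : ∀ j, 0 ≤ w j) (j : κ) :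
    w j * christoffel V w j ^ 2 ≤ ‖repKernel V w j‖ ^ 2 := by
  rw [christoffel, div_pow, Real.sq_sqrt (hw j)]
  rcases (hw j).eq_or_lt with h | h
  · rw [← h]; simp
  · rw [mul_div_cancel₀ _ h.ne']

/-- One step of the flattening iteration: the weight `ν`, damped at the points where the
Christoffel function of `w` exceeds `A`. -/
noncomputable def flatten (V : Submodule ℝ (κ → ℝ)) (ν : κ → ℝ) (A : ℝ) (w : κ → ℝ) (j : κ) : ℝ :=
  ν j * (A / max A (christoffel V w j))

variable {ν : κ → ℝ} {A : ℝ}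

theorem flatten_nonneg (hν : ∀ j, 0 ≤ ν j) (hA : 0 < A) (w : κ → ℝ) (j : κ) :
    0 ≤ flatten V ν A w j :=
  mul_nonneg (hν j) (div_nonneg hA.le (hA.le.trans (le_max_left _ _)))

theorem flatten_pos {j : κ} (hj : 0 < ν j) (hA : 0 < A) (w : κ → ℝ) : 0 < flatten V ν A w j :=
  mul_pos hj (div_pos hA (hA.trans_le (le_max_left _ _)))

theorem flatten_le (hν : ∀ j, 0 ≤ ν j) (hA : 0 < A) (w : κ → ℝ) (j : κ) :
    flatten V ν A w j ≤ ν j :=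
  mul_le_of_le_one_right (hν j) (div_le_one_of_le₀ (le_max_left _ _)
    (hA.le.trans (le_max_left _ _)))

/-- The flattening step is monotone and homogeneous of degree at most `1/2`, hence contracting. -/
theorem sqrt_mul_flatten_le (hν : ∀ j, 0 ≤ ν j) (hA : 0 < A) {w w' : κ → ℝ} {c : ℝ} (hc : 0 < c)
    (hc1 : c ≤ 1) (hw : ∀ j, 0 ≤ w j) (hνw : ∀ j, 0 < ν j → 0 < w j)
    (hww' : ∀ j, c * w j ≤ w' j) (j : κ) :
    √c * flatten V ν A w j ≤ flatten V ν A w' j := by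
  have hsc : 0 < √c := Real.sqrt_pos.2 hc
  have hsc1 : √c ≤ 1 := Real.sqrt_le_one.2 hc1
  rcases (hν j).eq_or_lt with h | h
  · simp [flatten, ← h]
  have hk := christoffel_le_div_sqrt (V := V) hc hw hww' (hνw j h)
  have h1 : 0 < max A (christoffel V w j) := hA.trans_le (le_max_left _ _)
  have h2 : 0 < max A (christoffel V w' j) := hA.trans_le (le_max_left _ _)
  have hmax : √c * max A (christoffel V w' j) ≤ max A (christoffel V w j) := by
    rw [le_div_iff₀ hsc] at hk
    rw [mul_max_of_nonneg _ _ hsc.le]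
    refine max_le_max ?_ (by linarith)
    nlinarith
  unfold flatten
  rw [mul_left_comm]
  refine mul_le_mul_of_nonneg_left ?_ h.le
  rw [mul_div_assoc', div_le_div_iff₀ h1 h2]
  nlinarith

/-- There is a weight which the flattening step reproduces up to a factor `2`. Such a weight is
reached from `ν` by iteration: consecutive iterates decrease, and the square root of their ratio
bounds the next ratio, so that the ratio tends to `1`. -/
theorem exists_flat_weight (V : Submodule ℝ (κ → ℝ)) (hν : ∀ j, 0 ≤ ν j) (hA : 0 < A) :
    ∃ w : κ → ℝ, (∀ j, 0 ≤ w j) ∧ (∀ j, 0 < ν j → 0 < w j) ∧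
      (∀ j, flatten V ν A w j ≤ w j) ∧ ∀ j, w j ≤ 2 * flatten V ν A w j := by
  let u : ℕ → κ → ℝ := fun t => (flatten V ν A)^[t] ν
  have hu : ∀ t, u (t + 1) = flatten V ν A (u t) := fun t => Function.iterate_succ_apply' _ _ _
  have hu0 : ∀ t j, 0 ≤ u t j := by
    rintro (_ | t) j
    · exact hν j
    · rw [hu]; exact flatten_nonneg hν hA _ _
  have hupos : ∀ t j, 0 < ν j → 0 < u t j := by
    rintro (_ | t) j h
    · exact h
    · rw [hu]; exact flatten_pos h hA _
  have hanti : ∀ t j, u (t + 1) j ≤ u t j := by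
    intro t
    induction t with
    | zero => intro j; rw [hu]; exact flatten_le hν hA _ _
    | succ t ih =>
      intro j
      have := sqrt_mul_flatten_le (V := V) (w' := u t) hν hA one_pos le_rfl (hu0 (t + 1)) (hupos (t + 1))
        (fun j => by rw [one_mul]; exact ih j) j
      rw [Real.sqrt_one, one_mul] at this
      rw [hu (t + 1)]
      conv_rhs => rw [hu t]
      exact this
  obtain ⟨c, hc, hcu⟩ : ∃ c : ℝ, 0 < c ∧ ∀ j, c * u 0 j ≤ u 1 j := by
    refine ⟨A / (A + ∑ k, christoffel V ν k), ?_, fun j => ?_⟩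
    · have := Finset.sum_nonneg fun k (_ : k ∈ Finset.univ) => christoffel_nonneg V ν k
      positivity
    · rw [hu 0]
      change _ * ν j ≤ ν j * _
      rw [mul_comm]
      refine mul_le_mul_of_nonneg_left ?_ (hν j)
      have h1 := Finset.single_le_sum (fun k _ => christoffel_nonneg V ν k) (Finset.mem_univ j)
      have h2 := Finset.sum_nonneg fun k (_ : k ∈ Finset.univ) => christoffel_nonneg V ν k
      change _ ≤ A / max A (christoffel V ν j)
      refine div_le_div_of_nonneg_left hA.le (hA.trans_le (le_max_left _ _)) ?_
      exact max_le (by linarith) (by linarith)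
  have hratio : ∀ t, ∀ c' : ℝ, 0 < c' → c' ≤ 1 → c' ^ 2 ^ t ≤ c →
      ∀ j, c' * u t j ≤ u (t + 1) j := by
    intro t
    induction t with
    | zero =>
      intro c' _ _ h j
      rw [pow_zero, pow_one] at h
      exact (mul_le_mul_of_nonneg_right h (hu0 0 j)).trans (hcu j)
    | succ t ih =>
      intro c' h0 h1 h j
      rw [pow_succ', pow_mul] at h
      have := sqrt_mul_flatten_le (V := V) hν hA (pow_pos h0 2) (pow_le_one₀ h0.le h1) (hu0 t)
        (hupos t) (ih (c' ^ 2) (pow_pos h0 2) (pow_le_one₀ h0.le h1) h) j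
      rw [Real.sqrt_sq h0.le] at this
      rw [hu (t + 1)]
      rw [hu t] at this ⊢
      exact this
  obtain ⟨t, ht⟩ := exists_pow_lt_of_lt_one hc (show (1 / 2 : ℝ) < 1 by norm_num)
  have ht2 : (1 / 2 : ℝ) ^ 2 ^ t ≤ c :=
    (pow_le_pow_of_le_one (by norm_num) (by norm_num) Nat.lt_two_pow_self.le).trans ht.le
  refine ⟨u t, hu0 t, hupos t, fun j => ?_, fun j => ?_⟩
  · rw [← hu]; exact hanti t j
  · have := hratio t (1 / 2) (by norm_num) (by norm_num) ht2 j
    rw [hu] at this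
    linarith

/-- The points where the Christoffel function of a flat weight exceeds `A` have small mass. -/
theorem sum_christoffel_gt_le (hA : 0 < A) {w : κ → ℝ} (hw : ∀ j, 0 ≤ w j)
    (hfw : ∀ j, flatten V ν A w j ≤ w j) (hν : ∀ j, 0 ≤ ν j) :
    A ^ 2 * ∑ j with A < christoffel V w j, ν j ≤ Module.finrank ℝ V := by
  refine le_trans ?_ (sum_norm_repKernel_sq_le V w)
  rw [Finset.mul_sum]
  refine le_trans ?_ (Finset.sum_le_sum_of_subset_of_nonneg (Finset.filter_subset
    (fun j => A < christoffel V w j) _) fun j _ _ => sq_nonneg _)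
  refine Finset.sum_le_sum fun j hj => ?_
  have hj' := (Finset.mem_filter.1 hj).2
  have hk := hA.trans hj'
  refine le_trans ?_ (mul_christoffel_sq_le hw j)
  have h := hfw j
  rw [flatten, max_eq_right hj'.le] at h
  calc A ^ 2 * ν j = ν j * A * A := by ring
    _ ≤ ν j * A * christoffel V w j := by
        have := hν j
        gcongr
    _ = ν j * (A / christoffel V w j) * christoffel V w j ^ 2 := by field_simp
    _ ≤ _ := by gcongr

end Christoffel

/-! ### Discrepancy of low-rank matrices -/

section Discrepancy

open scoped InnerProductSpace

variable {ι κ : Type*} [Fintype ι] [Fintype κ]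

/-- If the rows of `E` lie in a space of dimension at most `d` and every signed sum of the weighted
entries is at most `D`, then the weighted `L¹`-`L²` norm of `E` is `O(√(d / ν(κ)) D)`, up to
discarding a quarter of the columns. The Hilbert space vectors entering Grothendieck's inequality
are the rows and the reproducing kernels of a flat weight, normalized. -/
theorem exists_columns_sum_sqrt_le {μ : ι → ℝ} {ν : κ → ℝ} (hμ : ∀ i, 0 ≤ μ i)
    (hν : ∀ j, 0 ≤ ν j) (hN : 0 < ∑ j, ν j) {V : Submodule ℝ (κ → ℝ)} {d : ℝ} (hd : 0 < d)
    (hV : (Module.finrank ℝ V : ℝ) ≤ d) {E : ι → κ → ℝ} (hE : ∀ i, E i ∈ V) :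
    ∃ G : Finset κ, 3 / 4 * ∑ j, ν j ≤ ∑ j ∈ G, ν j ∧
      ∀ D : ℝ, (∀ (x : ι → ℝ) (y : κ → ℝ), (∀ i, |x i| ≤ 1) → (∀ j, |y j| ≤ 1) →
        ∑ i, ∑ j, μ i * ν j * E i j * (x i * y j) ≤ D) →
      ∑ i, μ i * √(∑ j ∈ G, ν j * E i j ^ 2) ≤ 16 * √(4 * d / ∑ j, ν j) * D := by
  classical
  set N := ∑ j, ν j with hNdef
  set A := √(4 * d / N) with hAdef
  have hA2 : A ^ 2 = 4 * d / N := Real.sq_sqrt (by positivity)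
  have hA : 0 < A := Real.sqrt_pos.2 (by positivity)
  obtain ⟨w, hw, hwpos, hfw, hwf⟩ := exists_flat_weight V hν hA
  refine ⟨Finset.univ.filter fun j => ¬ A < christoffel V w j, ?_, fun D hD => ?_⟩
  · have h1 := sum_christoffel_gt_le hA hw hfw hν
    have h2 := Finset.sum_filter_add_sum_filter_not Finset.univ
      (fun j => A < christoffel V w j) ν
    rw [← hNdef] at h2
    have h3 : A ^ 2 * ∑ j with A < christoffel V w j, ν j ≤ A ^ 2 * (N / 4) := by
      refine (h1.trans hV).trans (le_of_eq ?_)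
      rw [hA2]
      field_simp
    have h4 := le_of_mul_le_mul_left h3 (by positivity)
    linarith
  · have hgr := grothendieck_inequality (fun i j => μ i * ν j * E i j) hD
      (fun i k => weightedEmb w (E i) k / ‖weightedEmb w (E i)‖)
      (fun j k => repKernel V w j k / ‖repKernel V w j‖)
      (fun i => by
        simp only [div_pow]
        rw [← Finset.sum_div]
        refine div_le_one_of_le₀ (le_of_eq ?_) (sq_nonneg _)
        rw [EuclideanSpace.norm_sq_eq]
        simp only [Real.norm_eq_abs, sq_abs])
      (fun j => by
        simp only [div_pow]
        rw [← Finset.sum_div]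
        refine div_le_one_of_le₀ (le_of_eq ?_) (sq_nonneg _)
        rw [EuclideanSpace.norm_sq_eq]
        simp only [Real.norm_eq_abs, sq_abs])
    have hinner : ∀ i j, ∑ k, weightedEmb w (E i) k / ‖weightedEmb w (E i)‖ *
        (repKernel V w j k / ‖repKernel V w j‖)
        = √(w j) * E i j / (‖weightedEmb w (E i)‖ * ‖repKernel V w j‖) := by
      intro i j
      rw [← inner_weightedEmb_repKernel w (hE i) j, PiLp.inner_apply, Finset.sum_div]
      refine Finset.sum_congr rfl fun k _ => ?_
      rw [div_mul_div_comm]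
      simp [mul_comm]
    have hterm : ∀ i j, μ i * (w j * E i j ^ 2) / (2 * A * ‖weightedEmb w (E i)‖)
        ≤ μ i * ν j * E i j *
          (√(w j) * E i j / (‖weightedEmb w (E i)‖ * ‖repKernel V w j‖)) := by
      intro i j
      have hwfj := hwf j
      rcases (hν j).eq_or_lt with h0 | h0
      · have : w j = 0 := by
          refine le_antisymm ?_ (hw j)
          rwa [flatten, ← h0, zero_mul, mul_zero] at hwfj
        simp [this]
      have hwj := hwpos j h0
      have hs : 0 < √(w j) := Real.sqrt_pos.2 hwj
      have hrep : ‖repKernel V w j‖ = christoffel V w j * √(w j) := by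
        rw [christoffel, div_mul_cancel₀ _ hs.ne']
      rcases (christoffel_nonneg V w j).eq_or_lt with hk | hk
      · have := abs_le_christoffel_mul_norm hwj (hE i)
        rw [← hk, zero_mul] at this
        have hz : E i j = 0 := abs_nonpos_iff.1 this
        simp [hz]
      rcases (norm_nonneg (weightedEmb w (E i))).eq_or_lt with he | he
      · simp [← he]
      have hle : w j * christoffel V w j ≤ 2 * A * ν j := by
        rw [flatten] at hwfj
        have hm : A / max A (christoffel V w j) ≤ A / christoffel V w j :=
          div_le_div_of_nonneg_left hA.le hk (le_max_right _ _)
        have : w j ≤ 2 * (ν j * (A / christoffel V w j)) := by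
          refine hwfj.trans ?_
          gcongr
        calc w j * christoffel V w j ≤ 2 * (ν j * (A / christoffel V w j)) * christoffel V w j := by
              gcongr
          _ = _ := by field_simp
      rw [hrep, show μ i * ν j * E i j * (√(w j) * E i j / (‖weightedEmb w (E i)‖ *
          (christoffel V w j * √(w j)))) = μ i * (ν j * E i j ^ 2) /
          (‖weightedEmb w (E i)‖ * christoffel V w j) by field_simp]
      rw [div_le_div_iff₀ (by positivity) (by positivity)]
      have h5 : 0 ≤ μ i * E i j ^ 2 * ‖weightedEmb w (E i)‖ :=
        mul_nonneg (mul_nonneg (hμ i) (sq_nonneg _)) he.le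
      calc _ = (μ i * E i j ^ 2 * ‖weightedEmb w (E i)‖) * (w j * christoffel V w j) := by ring
        _ ≤ (μ i * E i j ^ 2 * ‖weightedEmb w (E i)‖) * (2 * A * ν j) := by gcongr
        _ = _ := by ring
    have hrow : ∀ i, μ i * √(∑ j with ¬ A < christoffel V w j, ν j * E i j ^ 2) / (2 * A)
        ≤ ∑ j, μ i * (w j * E i j ^ 2) / (2 * A * ‖weightedEmb w (E i)‖) := by
      intro i
      rw [← Finset.sum_div, ← Finset.mul_sum, ← norm_weightedEmb_sq hw]
      have hG : √(∑ j with ¬ A < christoffel V w j, ν j * E i j ^ 2) ≤ ‖weightedEmb w (E i)‖ := by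
        refine Real.sqrt_le_iff.2 ⟨norm_nonneg _, ?_⟩
        rw [norm_weightedEmb_sq hw]
        refine le_trans (Finset.sum_le_sum fun j hj => ?_)
          (Finset.sum_le_sum_of_subset_of_nonneg (Finset.filter_subset _ _)
            fun j _ _ => mul_nonneg (hw j) (sq_nonneg _))
        have hj' := not_lt.1 (Finset.mem_filter.1 hj).2
        have := hfw j
        rw [flatten, max_eq_left hj', div_self hA.ne', mul_one] at this
        gcongr
      rcases (norm_nonneg (weightedEmb w (E i))).eq_or_lt with he | he
      · rw [← he] at hG
        have := le_antisymm hG (Real.sqrt_nonneg _)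
        rw [this, ← he]
        simp
      · rw [div_le_div_iff₀ (by positivity) (by positivity)]
        have := hμ i
        calc _ ≤ μ i * ‖weightedEmb w (E i)‖ * (2 * A * ‖weightedEmb w (E i)‖) := by gcongr
          _ = _ := by ring
    simp only [hinner] at hgr
    have hfin : (∑ i, μ i * √(∑ j with ¬ A < christoffel V w j, ν j * E i j ^ 2)) / (2 * A)
        ≤ 8 * D := by
      rw [Finset.sum_div]
      refine (Finset.sum_le_sum fun i _ => (hrow i).trans
        (Finset.sum_le_sum fun j _ => hterm i j)).trans hgr
    rw [div_le_iff₀ (by positivity)] at hfin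
    linarith

/-! ### Decreasing the density -/

/-- The weighted sum `∑ μ(i) ν(j) M(i,j)` of the entries of `M`. -/
def wsum (μ : ι → ℝ) (ν : κ → ℝ) (M : Matrix ι κ ℝ) : ℝ :=
  ∑ i, ∑ j, μ i * ν j * M i j

theorem wsum_nonneg {μ : ι → ℝ} {ν : κ → ℝ} {M : Matrix ι κ ℝ} (hμ : ∀ i, 0 ≤ μ i)
    (hν : ∀ j, 0 ≤ ν j) (hM : ∀ i j, 0 ≤ M i j) : 0 ≤ wsum μ ν M :=
  Finset.sum_nonneg fun i _ => Finset.sum_nonneg fun j _ =>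
    mul_nonneg (mul_nonneg (hμ i) (hν j)) (hM i j)

/-- A signed sum `D` of the entries of `M - ε` is turned into weights, at least a third of the
original ones, on which the average of `M` is smaller than `ε`. The product weights
`(2 ± x)(2 ∓ y)` are bounded below, and their two sums add up to `-2 D`. -/
theorem exists_weights_of_discrepancy {μ : ι → ℝ} {ν : κ → ℝ} {M : Matrix ι κ ℝ}
    (hμ : ∀ i, 0 ≤ μ i) (hν : ∀ j, 0 ≤ ν j) {ε D : ℝ}
    (hε : wsum μ ν M = ε * ((∑ i, μ i) * ∑ j, ν j)) {x : ι → ℝ} {y : κ → ℝ}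
    (hx : ∀ i, |x i| ≤ 1) (hy : ∀ j, |y j| ≤ 1)
    (hD : D ≤ ∑ i, ∑ j, μ i * ν j * (M i j - ε) * (x i * y j)) :
    ∃ (μ' : ι → ℝ) (ν' : κ → ℝ), (∀ i, 0 ≤ μ' i ∧ μ' i ≤ μ i) ∧ (∀ j, 0 ≤ ν' j ∧ ν' j ≤ ν j) ∧
      ∑ i, μ i ≤ 3 * ∑ i, μ' i ∧ ∑ j, ν j ≤ 3 * ∑ j, ν' j ∧
      wsum μ' ν' M ≤ ε * ((∑ i, μ' i) * ∑ j, ν' j) - D / 9 := by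
  have hsum : ∀ (μ' : ι → ℝ) (ν' : κ → ℝ), ∑ i, ∑ j, μ' i * ν' j * (M i j - ε)
      = wsum μ' ν' M - ε * ((∑ i, μ' i) * ∑ j, ν' j) := by
    intro μ' ν'
    rw [wsum, Finset.sum_mul_sum, Finset.mul_sum, ← Finset.sum_sub_distrib]
    refine Finset.sum_congr rfl fun i _ => ?_
    rw [Finset.mul_sum, ← Finset.sum_sub_distrib]
    exact Finset.sum_congr rfl fun j _ => by ring
  have key : ∀ (x : ι → ℝ) (y : κ → ℝ), (∀ i, |x i| ≤ 1) → (∀ j, |y j| ≤ 1) →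
      ∑ i, ∑ j, (μ i * ((2 + x i) / 3)) * (ν j * ((2 - y j) / 3)) * (M i j - ε) ≤ - D / 9 →
      ∃ (μ' : ι → ℝ) (ν' : κ → ℝ), (∀ i, 0 ≤ μ' i ∧ μ' i ≤ μ i) ∧
        (∀ j, 0 ≤ ν' j ∧ ν' j ≤ ν j) ∧
        ∑ i, μ i ≤ 3 * ∑ i, μ' i ∧ ∑ j, ν j ≤ 3 * ∑ j, ν' j ∧
        wsum μ' ν' M ≤ ε * ((∑ i, μ' i) * ∑ j, ν' j) - D / 9 := by
    intro x y hx hy h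
    refine ⟨fun i => μ i * ((2 + x i) / 3), fun j => ν j * ((2 - y j) / 3), fun i => ?_,
      fun j => ?_, ?_, ?_, ?_⟩
    · have := abs_le.1 (hx i)
      exact ⟨mul_nonneg (hμ i) (by linarith), mul_le_of_le_one_right (hμ i) (by linarith)⟩
    · have := abs_le.1 (hy j)
      exact ⟨mul_nonneg (hν j) (by linarith), mul_le_of_le_one_right (hν j) (by linarith)⟩
    · rw [Finset.mul_sum]
      refine Finset.sum_le_sum fun i _ => ?_
      have := abs_le.1 (hx i)
      nlinarith [hμ i]
    · rw [Finset.mul_sum]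
      refine Finset.sum_le_sum fun j _ => ?_
      have := abs_le.1 (hy j)
      nlinarith [hν j]
    · rw [hsum] at h
      linarith
  have h0 : ∑ i, ∑ j, μ i * ν j * (M i j - ε) = 0 := by rw [hsum, hε, sub_self]
  have hadd : ∑ i, ∑ j, (μ i * ((2 + x i) / 3)) * (ν j * ((2 - y j) / 3)) * (M i j - ε)
      + ∑ i, ∑ j, (μ i * ((2 + -x i) / 3)) * (ν j * ((2 - -y j) / 3)) * (M i j - ε)
      = 8 / 9 * ∑ i, ∑ j, μ i * ν j * (M i j - ε)
        - 2 / 9 * ∑ i, ∑ j, μ i * ν j * (M i j - ε) * (x i * y j) := by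
    simp only [Finset.mul_sum]
    simp only [← Finset.sum_sub_distrib, ← Finset.sum_add_distrib]
    exact Finset.sum_congr rfl fun i _ => Finset.sum_congr rfl fun j _ => by ring
  rw [h0] at hadd
  by_cases h : ∑ i, ∑ j, (μ i * ((2 + x i) / 3)) * (ν j * ((2 - y j) / 3)) * (M i j - ε) ≤ - D / 9
  · exact key x y hx hy h
  · refine key (fun i => -x i) (fun j => -y j) (by simpa using hx) (by simpa using hy) ?_
    push Not at h
    linarith

/-- The density decrement: on suitable weights, which lose at most a factor `3`, the density `ε`
of a matrix of rank at most `r` drops by a factor `2/3` or by an amount of order `√(ε / r)`. -/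
theorem exists_weights_density_le {μ : ι → ℝ} {ν : κ → ℝ} {M : Matrix ι κ ℝ}
    (hM : ∀ i j, M i j = 0 ∨ 1 ≤ M i j) {r : ℕ} (hr : 0 < r) (hrank : M.rank ≤ r)
    (hμ : ∀ i, 0 ≤ μ i) (hν : ∀ j, 0 ≤ ν j) (hP : 0 < ∑ i, μ i) (hN : 0 < ∑ j, ν j) {ε : ℝ}
    (hε0 : 0 < ε) (hε1 : ε ≤ 1 / 2) (hε : wsum μ ν M = ε * ((∑ i, μ i) * ∑ j, ν j)) :
    ∃ (μ' : ι → ℝ) (ν' : κ → ℝ), (∀ i, 0 ≤ μ' i ∧ μ' i ≤ μ i) ∧ (∀ j, 0 ≤ ν' j ∧ ν' j ≤ ν j) ∧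
      ∑ i, μ i ≤ 3 * ∑ i, μ' i ∧ ∑ j, ν j ≤ 3 * ∑ j, ν' j ∧
      wsum μ' ν' M ≤ max (2 / 3 * ε) (ε - √(ε / r) / 2304) * ((∑ i, μ' i) * ∑ j, ν' j) := by
  classical
  have hM0 : ∀ i j, 0 ≤ M i j := fun i j => by rcases hM i j with h | h <;> linarith
  have hr' : (1 : ℝ) ≤ r := by exact_mod_cast hr
  -- The rows of `M - ε` lie in the span of the rows of `M` and the constants.
  let V : Submodule ℝ (κ → ℝ) := Submodule.span ℝ (Set.range M.row) ⊔ Submodule.span ℝ {1}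
  have hV : (Module.finrank ℝ V : ℝ) ≤ 2 * r := by
    have h1 : Module.finrank ℝ V ≤ r + 1 := by
      refine (Submodule.finrank_add_le_finrank_add_finrank _ _).trans ?_
      refine add_le_add ?_ ?_
      · rw [← Matrix.rank_eq_finrank_span_row]; exact hrank
      · exact (finrank_span_le_card _).trans (by simp)
    have : (Module.finrank ℝ V : ℝ) ≤ r + 1 := by exact_mod_cast h1
    linarith
  have hE : ∀ i, (fun j => M i j - ε) ∈ V := by
    intro i
    have h1 : M.row i ∈ V := Submodule.mem_sup_left (Submodule.subset_span ⟨i, rfl⟩)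
    have h2 : (1 : κ → ℝ) ∈ V := Submodule.mem_sup_right (Submodule.mem_span_singleton_self _)
    have h3 := V.sub_mem h1 (V.smul_mem ε h2)
    convert! h3 using 1
    ext j
    simp [Matrix.row]
  obtain ⟨G, hG, hdisc⟩ := exists_columns_sum_sqrt_le hμ hν hN (by positivity) hV hE
  set P := ∑ i, μ i with hPdef
  set N := ∑ j, ν j with hNdef
  set s : ι → ℝ := fun i => ∑ j ∈ G, ν j * M i j with hs
  set L : Finset ι := Finset.univ.filter fun i => s i ≤ ε * N / 2 with hL
  have hGN : ∑ j ∈ G, ν j ≤ N :=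
    Finset.sum_le_sum_of_subset_of_nonneg (Finset.subset_univ _) fun j _ _ => hν j
  have hsplit : ∑ i ∈ L, μ i + ∑ i with ¬ s i ≤ ε * N / 2, μ i = P :=
    Finset.sum_filter_add_sum_filter_not _ _ _
  by_cases hcase : P / 2 ≤ ∑ i ∈ L, μ i
  · -- Half of the rows are sparse: restrict to them.
    have e1 : ∑ i, (if i ∈ L then μ i else 0) = ∑ i ∈ L, μ i := by
      simp [Finset.sum_ite_mem]
    have e2 : ∑ j, (if j ∈ G then ν j else 0) = ∑ j ∈ G, ν j := by
      simp [Finset.sum_ite_mem]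
    refine ⟨fun i => if i ∈ L then μ i else 0, fun j => if j ∈ G then ν j else 0, fun i => ?_,
      fun j => ?_, ?_, ?_, ?_⟩
    · have := hμ i
      dsimp only
      split_ifs <;> simp [this]
    · have := hν j
      dsimp only
      split_ifs <;> simp [this]
    · rw [e1]; linarith
    · rw [e2]; linarith
    · rw [e1, e2]
      have e3 : wsum (fun i => if i ∈ L then μ i else 0) (fun j => if j ∈ G then ν j else 0) M
          = ∑ i ∈ L, μ i * s i := by
        rw [wsum, ← Finset.sum_subset (Finset.subset_univ L)]
        · refine Finset.sum_congr rfl fun i hi => ?_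
          rw [hs, Finset.mul_sum, ← Finset.sum_subset (Finset.subset_univ G)]
          · exact Finset.sum_congr rfl fun j hj => by simp [hi, hj, mul_assoc]
          · intro j _ hj; simp [hj]
        · intro i _ hi; simp [hi]
      rw [e3]
      have hLpos : 0 ≤ ∑ i ∈ L, μ i := Finset.sum_nonneg fun i _ => hμ i
      have hGpos : 0 ≤ ∑ j ∈ G, ν j := Finset.sum_nonneg fun j _ => hν j
      calc ∑ i ∈ L, μ i * s i ≤ ∑ i ∈ L, μ i * (ε * N / 2) :=
            Finset.sum_le_sum fun i hi =>
              mul_le_mul_of_nonneg_left (Finset.mem_filter.1 hi).2 (hμ i)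
        _ = (∑ i ∈ L, μ i) * (ε * N / 2) := by rw [Finset.sum_mul]
        _ ≤ (∑ i ∈ L, μ i) * (2 / 3 * ε * ∑ j ∈ G, ν j) := by
            refine mul_le_mul_of_nonneg_left ?_ hLpos
            nlinarith
        _ = 2 / 3 * ε * ((∑ i ∈ L, μ i) * ∑ j ∈ G, ν j) := by ring
        _ ≤ _ := mul_le_mul_of_nonneg_right (le_max_left _ _) (mul_nonneg hLpos hGpos)
  · -- Half of the rows of `M - ε` have a large weighted `L²` norm.
    have hrow : ∀ i, ¬ s i ≤ ε * N / 2 →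
        √(3 * (ε * N) / 8) ≤ √(∑ j ∈ G, ν j * (M i j - ε) ^ 2) := by
      intro i hi
      refine Real.sqrt_le_sqrt ?_
      have h1 : (1 - 2 * ε) * s i + ε ^ 2 * ∑ j ∈ G, ν j ≤ ∑ j ∈ G, ν j * (M i j - ε) ^ 2 := by
        rw [hs, Finset.mul_sum, Finset.mul_sum, ← Finset.sum_add_distrib]
        refine Finset.sum_le_sum fun j _ => ?_
        have : M i j ≤ M i j ^ 2 := by rcases hM i j with h | h <;> nlinarith
        nlinarith [hν j]
      push Not at hi
      have h2 : (1 - 2 * ε) * (ε * N / 2) ≤ (1 - 2 * ε) * s i :=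
        mul_le_mul_of_nonneg_left hi.le (by linarith)
      have h3 : ε ^ 2 * (3 / 4 * N) ≤ ε ^ 2 * ∑ j ∈ G, ν j :=
        mul_le_mul_of_nonneg_left hG (sq_nonneg _)
      have h4 : 0 < ε * N := mul_pos hε0 hN
      nlinarith
    have hlow : P / 2 * √(3 * (ε * N) / 8)
        < ∑ i, μ i * √(∑ j ∈ G, ν j * (M i j - ε) ^ 2) := by
      have h1 : P / 2 < ∑ i with ¬ s i ≤ ε * N / 2, μ i := by
        push Not at hcase
        linarith
      have h2 : 0 < √(3 * (ε * N) / 8) := Real.sqrt_pos.2 (by positivity)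
      calc _ < (∑ i with ¬ s i ≤ ε * N / 2, μ i) * √(3 * (ε * N) / 8) :=
            mul_lt_mul_of_pos_right h1 h2
        _ ≤ ∑ i with ¬ s i ≤ ε * N / 2, μ i * √(∑ j ∈ G, ν j * (M i j - ε) ^ 2) := by
            rw [Finset.sum_mul]
            exact Finset.sum_le_sum fun i hi =>
              mul_le_mul_of_nonneg_left (hrow i (Finset.mem_filter.1 hi).2) (hμ i)
        _ ≤ _ := Finset.sum_le_sum_of_subset_of_nonneg (Finset.filter_subset _ _)
            fun i _ _ => mul_nonneg (hμ i) (Real.sqrt_nonneg _)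
    obtain ⟨x, y, hx, hy, hxy⟩ : ∃ (x : ι → ℝ) (y : κ → ℝ), (∀ i, |x i| ≤ 1) ∧
        (∀ j, |y j| ≤ 1) ∧ √(ε / r) / 256 * (P * N)
          ≤ ∑ i, ∑ j, μ i * ν j * (M i j - ε) * (x i * y j) := by
      by_contra hcon
      push Not at hcon
      have h1 := hdisc _ fun x y hx hy => (hcon x y hx hy).le
      have h2 := hlow.trans_le h1
      -- The squares of the two sides are `P² ε N / 32` and `3 P² ε N / 32`.
      have hsq : (16 * √(4 * (2 * r) / N) * (√(ε / r) / 256 * (P * N))) ^ 2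
          ≤ (P / 2 * √(3 * (ε * N) / 8)) ^ 2 := by
        simp only [mul_pow, div_pow]
        rw [Real.sq_sqrt (by positivity), Real.sq_sqrt (by positivity),
          Real.sq_sqrt (by positivity)]
        have : 16 ^ 2 * (4 * (2 * r) / N) * (ε / r / 256 ^ 2 * (P ^ 2 * N ^ 2))
            = 1 / 32 * (P ^ 2 * (ε * N)) := by
          field_simp
          norm_num
        rw [this]
        have : 0 < P ^ 2 * (ε * N) := by positivity
        linarith
      exact absurd h2 (not_lt.2 (le_of_sq_le_sq hsq (by positivity)))
    obtain ⟨μ', ν', hμ', hν', hP', hN', hle⟩ :=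
      exists_weights_of_discrepancy hμ hν hε hx hy hxy
    refine ⟨μ', ν', hμ', hν', hP', hN', hle.trans ?_⟩
    have h1 : ∑ i, μ' i ≤ P := Finset.sum_le_sum fun i _ => (hμ' i).2
    have h2 : ∑ j, ν' j ≤ N := Finset.sum_le_sum fun j _ => (hν' j).2
    have h3 : 0 ≤ ∑ i, μ' i := Finset.sum_nonneg fun i _ => (hμ' i).1
    have h4 : 0 ≤ ∑ j, ν' j := Finset.sum_nonneg fun j _ => (hν' j).1
    have h5 : (∑ i, μ' i) * ∑ j, ν' j ≤ P * N := mul_le_mul h1 h2 h4 hP.le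
    have h6 : 0 ≤ √(ε / r) := Real.sqrt_nonneg _
    calc _ ≤ (ε - √(ε / r) / 2304) * ((∑ i, μ' i) * ∑ j, ν' j) := by nlinarith
      _ ≤ _ := mul_le_mul_of_nonneg_right (le_max_right _ _) (mul_nonneg h3 h4)

/-- Iterating the density decrement: `√(ε r)` drops by a constant in every round, until the density
is at most `1 / (4 r)`. -/
theorem exists_weights_density_le_inv {M : Matrix ι κ ℝ}
    (hM : ∀ i j, M i j = 0 ∨ 1 ≤ M i j) {r : ℕ} (hr : 0 < r) (hrank : M.rank ≤ r) (n : ℕ) :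
    ∀ (μ : ι → ℝ) (ν : κ → ℝ) (ε : ℝ), (∀ i, 0 ≤ μ i) → (∀ j, 0 ≤ ν j) → 0 < ∑ i, μ i →
      0 < ∑ j, ν j → 0 ≤ ε → ε ≤ 1 / 2 → wsum μ ν M = ε * ((∑ i, μ i) * ∑ j, ν j) →
      √(ε * r) ≤ 1 / 2 + n / 4608 →
      ∃ (μ' : ι → ℝ) (ν' : κ → ℝ), (∀ i, 0 ≤ μ' i ∧ μ' i ≤ μ i) ∧
        (∀ j, 0 ≤ ν' j ∧ ν' j ≤ ν j) ∧
        ∑ i, μ i ≤ 3 ^ n * ∑ i, μ' i ∧ ∑ j, ν j ≤ 3 ^ n * ∑ j, ν' j ∧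
        wsum μ' ν' M ≤ 1 / (4 * r) * ((∑ i, μ' i) * ∑ j, ν' j) := by
  have hM0 : ∀ i j, 0 ≤ M i j := fun i j => by rcases hM i j with h | h <;> linarith
  have hr' : (0 : ℝ) < r := by exact_mod_cast hr
  induction n with
  | zero =>
    intro μ ν ε hμ hν hP hN hε0 hε1 hε hs
    refine ⟨μ, ν, fun i => ⟨hμ i, le_rfl⟩, fun j => ⟨hν j, le_rfl⟩, by simp, by simp, ?_⟩
    rw [hε]
    refine mul_le_mul_of_nonneg_right ?_ (mul_nonneg hP.le hN.le)
    rw [Nat.cast_zero, zero_div, add_zero, Real.sqrt_le_left (by norm_num)] at hs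
    rw [le_div_iff₀ (by positivity)]
    linarith
  | succ n ih =>
    intro μ ν ε hμ hν hP hN hε0 hε1 hε hs
    by_cases hsmall : √(ε * r) ≤ 1 / 2 + n / 4608
    · obtain ⟨μ', ν', hμ', hν', hP', hN', hle⟩ := ih μ ν ε hμ hν hP hN hε0 hε1 hε hsmall
      have h3 : (3 : ℝ) ^ n ≤ 3 ^ (n + 1) := pow_le_pow_right₀ (by norm_num) (Nat.le_succ n)
      refine ⟨μ', ν', hμ', hν', hP'.trans ?_, hN'.trans ?_, hle⟩
      · exact mul_le_mul_of_nonneg_right h3 (Finset.sum_nonneg fun i _ => (hμ' i).1)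
      · exact mul_le_mul_of_nonneg_right h3 (Finset.sum_nonneg fun j _ => (hν' j).1)
    push Not at hsmall
    have hhalf : 1 / 2 < √(ε * r) := lt_of_le_of_lt (by
      have : (0 : ℝ) ≤ n / 4608 := by positivity
      linarith) hsmall
    have hεpos : 0 < ε := by
      refine hε0.lt_of_ne ?_
      rintro rfl
      rw [zero_mul, Real.sqrt_zero] at hhalf
      linarith
    obtain ⟨μ₁, ν₁, hμ₁, hν₁, hP₁, hN₁, hle₁⟩ :=
      exists_weights_density_le hM hr hrank hμ hν hP hN hεpos hε1 hε
    have hP₁0 : 0 < ∑ i, μ₁ i := by linarith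
    have hN₁0 : 0 < ∑ j, ν₁ j := by linarith
    have hPN : 0 < (∑ i, μ₁ i) * ∑ j, ν₁ j := mul_pos hP₁0 hN₁0
    have hε' : wsum μ₁ ν₁ M / ((∑ i, μ₁ i) * ∑ j, ν₁ j)
        ≤ max (2 / 3 * ε) (ε - √(ε / r) / 2304) := (div_le_iff₀ hPN).2 hle₁
    set ε₁ := wsum μ₁ ν₁ M / ((∑ i, μ₁ i) * ∑ j, ν₁ j) with hε₁
    have hε₁0 : 0 ≤ ε₁ :=
      div_nonneg (wsum_nonneg (fun i => (hμ₁ i).1) (fun j => (hν₁ j).1) hM0) hPN.le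
    have hε₁ε : ε₁ ≤ ε := hε'.trans (max_le (by linarith) (by
      have := Real.sqrt_nonneg (ε / r)
      linarith))
    have hsr : √(ε / r) * r = √(ε * r) := by
      rw [show ε * r = ε / r * r ^ 2 by field_simp, Real.sqrt_mul (by positivity),
        Real.sqrt_sq hr'.le]
    have hs2 : √(ε * r) ^ 2 = ε * r := Real.sq_sqrt (by positivity)
    have hdrop : √(ε₁ * r) ≤ √(ε * r) - 1 / 4608 := by
      refine Real.sqrt_le_iff.2 ⟨by linarith, ?_⟩
      have h1 : ε₁ * r ≤ max (2 / 3 * ε) (ε - √(ε / r) / 2304) * r :=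
        mul_le_mul_of_nonneg_right hε' hr'.le
      refine h1.trans ?_
      rcases max_cases (2 / 3 * ε) (ε - √(ε / r) / 2304) with ⟨h, _⟩ | ⟨h, _⟩ <;> rw [h]
      · nlinarith
      · have : (ε - √(ε / r) / 2304) * r = √(ε * r) ^ 2 - √(ε * r) / 2304 := by
          rw [hs2, ← hsr]; ring
        rw [this]
        nlinarith
    obtain ⟨μ', ν', hμ', hν', hP', hN', hle⟩ := ih μ₁ ν₁ ε₁ (fun i => (hμ₁ i).1)
      (fun j => (hν₁ j).1) hP₁0 hN₁0 hε₁0 (hε₁ε.trans hε1) (div_mul_cancel₀ _ hPN.ne').symm (by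
        push_cast at hs
        linarith)
    refine ⟨μ', ν', fun i => ⟨(hμ' i).1, (hμ' i).2.trans (hμ₁ i).2⟩,
      fun j => ⟨(hν' j).1, (hν' j).2.trans (hν₁ j).2⟩, ?_, ?_, hle⟩
    · rw [pow_succ']; linarith
    · rw [pow_succ']; linarith

end Discrepancy

/-! ### From small density to an all-zero submatrix -/

section ZeroSubmatrix

variable {ι κ : Type*} [Fintype ι] [Fintype κ]

/-- A set of rows contains at most `rank M` rows whose common zeros are zeros of all of them. -/
theorem exists_rows_spanning (M : Matrix ι κ ℝ) (L : Finset ι) :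
    ∃ (d : ℕ) (f : Fin d → ι), d ≤ M.rank ∧ (∀ k, f k ∈ L) ∧
      ∀ j, (∀ k, M (f k) j = 0) → ∀ i ∈ L, M i j = 0 := by
  obtain ⟨g, hg, hspan, -⟩ := Submodule.exists_fun_fin_finrank_span_eq ℝ (M.row '' (L : Set ι))
  choose f hfL hfg using hg
  refine ⟨_, f, ?_, fun k => hfL k, fun j hj i hi => ?_⟩
  · rw [Matrix.rank_eq_finrank_span_row]
    exact Submodule.finrank_mono (Submodule.span_mono (Set.image_subset_range _ _))
  · have hmem : M.row i ∈ Submodule.span ℝ (Set.range g) := by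
      rw [hspan]; exact Submodule.subset_span ⟨i, hi, rfl⟩
    have hle : Submodule.span ℝ (Set.range g) ≤ LinearMap.ker (LinearMap.proj (R := ℝ) j) := by
      rw [Submodule.span_le]
      rintro _ ⟨k, rfl⟩
      rw [← hfg k]
      exact hj k
    exact hle hmem

/-- A matrix of rank at most `r` and density at most `ε` vanishes on all but an `ε / τ` part of the
rows and an `r τ` part of the columns: take the rows with at most a `τ` part of nonzero entries, and
the common zeros of `r` rows spanning them. -/
theorem exists_zero_submatrix_of_density_le {μ : ι → ℝ} {ν : κ → ℝ} {M : Matrix ι κ ℝ}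
    (hM : ∀ i j, M i j = 0 ∨ 1 ≤ M i j) {r : ℕ} (hrank : M.rank ≤ r)
    (hμ : ∀ i, 0 ≤ μ i) (hν : ∀ j, 0 ≤ ν j) (hN : 0 < ∑ j, ν j) {ε τ : ℝ} (hτ : 0 < τ)
    (hε : wsum μ ν M ≤ ε * ((∑ i, μ i) * ∑ j, ν j)) :
    ∃ (R : Finset ι) (S : Finset κ), (1 - ε / τ) * ∑ i, μ i ≤ ∑ i ∈ R, μ i ∧
      (1 - r * τ) * ∑ j, ν j ≤ ∑ j ∈ S, ν j ∧ ∀ i ∈ R, ∀ j ∈ S, M i j = 0 := by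
  classical
  set N := ∑ j, ν j with hNdef
  set z : ι → ℝ := fun i => ∑ j with M i j ≠ 0, ν j with hz
  have hz0 : ∀ i, 0 ≤ z i := fun i => Finset.sum_nonneg fun j _ => hν j
  obtain ⟨d, f, hd, hfL, hf⟩ := exists_rows_spanning M (Finset.univ.filter fun i => z i ≤ τ * N)
  refine ⟨Finset.univ.filter fun i => z i ≤ τ * N, Finset.univ.filter fun j => ∀ k, M (f k) j = 0,
    ?_, ?_, fun i hi j hj => hf j (Finset.mem_filter.1 hj).2 i hi⟩
  · have h1 : ∑ i, μ i * z i ≤ wsum μ ν M := by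
      refine Finset.sum_le_sum fun i _ => ?_
      rw [hz, Finset.mul_sum, Finset.sum_filter]
      refine Finset.sum_le_sum fun j _ => ?_
      have := mul_nonneg (hμ i) (hν j)
      rcases hM i j with h | h
      · simp [h]
      · rw [if_pos (by linarith)]
        nlinarith
    have h2 : (∑ i with ¬ z i ≤ τ * N, μ i) * (τ * N) ≤ ∑ i, μ i * z i := by
      rw [Finset.sum_mul]
      refine le_trans (Finset.sum_le_sum fun i hi => ?_)
        (Finset.sum_le_sum_of_subset_of_nonneg (Finset.filter_subset _ _)
          fun i _ _ => mul_nonneg (hμ i) (hz0 i))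
      exact mul_le_mul_of_nonneg_left (not_le.1 (Finset.mem_filter.1 hi).2).le (hμ i)
    have h3 := Finset.sum_filter_add_sum_filter_not Finset.univ (fun i => z i ≤ τ * N) μ
    have h4 : ∑ i with ¬ z i ≤ τ * N, μ i ≤ ε / τ * ∑ i, μ i := by
      refine le_of_mul_le_mul_right ?_ (mul_pos hτ hN)
      calc _ ≤ ε * ((∑ i, μ i) * N) := (h2.trans h1).trans hε
        _ = _ := by field_simp
    linarith
  · have h1 : ∑ j with ¬ ∀ k, M (f k) j = 0, ν j ≤ ∑ k, z (f k) := by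
      simp only [hz, Finset.sum_filter]
      rw [Finset.sum_comm]
      refine Finset.sum_le_sum fun j _ => ?_
      have hn : ∀ k ∈ Finset.univ, 0 ≤ if M (f k) j ≠ 0 then ν j else 0 := fun k _ => by
        split_ifs
        exacts [hν j, le_rfl]
      split_ifs with h
      · exact Finset.sum_nonneg hn
      · push Not at h
        obtain ⟨k, hk⟩ := h
        refine le_trans ?_ (Finset.single_le_sum hn (Finset.mem_univ k))
        rw [if_pos hk]
    have h2 : ∑ k, z (f k) ≤ r * (τ * N) := by
      calc _ ≤ ∑ _k : Fin d, τ * N := Finset.sum_le_sum fun k _ => (Finset.mem_filter.1 (hfL k)).2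
        _ = d * (τ * N) := by simp
        _ ≤ _ := by
          refine mul_le_mul_of_nonneg_right ?_ (mul_pos hτ hN).le
          exact_mod_cast hd.trans hrank
    have h3 := Finset.sum_filter_add_sum_filter_not Finset.univ (fun j => ∀ k, M (f k) j = 0) ν
    linarith

end ZeroSubmatrix

/-! ### All-zero submatrices and constant submatrices -/

theorem IsNonnegSeparated.eq_zero_or_one_le {m n : ℕ} {M : Matrix (Fin m) (Fin n) ℝ}
    (hM : IsNonnegSeparated M) (i : Fin m) (j : Fin n) : M i j = 0 ∨ 1 ≤ M i j := by
  obtain ⟨h0, h1⟩ := hM i j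
  rcases h0.eq_or_lt with h | h
  · exact Or.inl h.symm
  · exact Or.inr (not_lt.1 fun h' => h1 ⟨h, h'⟩)

theorem HasSubmatrixEqual.mono {m n : ℕ} {M : Matrix (Fin m) (Fin n) ℝ} {v a b a' b' : ℝ}
    (h : HasSubmatrixEqual M v a b) (ha : a' ≤ a) (hb : b' ≤ b) : HasSubmatrixEqual M v a' b' := by
  obtain ⟨R, S, hR, hS, hRS⟩ := h
  exact ⟨R, S, ha.trans hR, hb.trans hS, hRS⟩

theorem HasZeroSubmatrix.of_exponent_le {m n : ℕ} {M : Matrix (Fin m) (Fin n) ℝ} {x y : ℝ}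
    (h : HasZeroSubmatrix M ((m : ℝ) * (2 : ℝ) ^ (-x)) ((n : ℝ) * (2 : ℝ) ^ (-x))) (hxy : x ≤ y) :
    HasZeroSubmatrix M ((m : ℝ) * (2 : ℝ) ^ (-y)) ((n : ℝ) * (2 : ℝ) ^ (-y)) := by
  have hpow : (2 : ℝ) ^ (-y) ≤ (2 : ℝ) ^ (-x) :=
    Real.rpow_le_rpow_of_exponent_le one_le_two (by linarith)
  exact HasSubmatrixEqual.mono h (by gcongr) (by gcongr)

theorem avgEntry_nonneg {m n : ℕ} {M : Matrix (Fin m) (Fin n) ℝ} (hM : IsNonnegSeparated M) :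
    0 ≤ avgEntry M :=
  div_nonneg (Finset.sum_nonneg fun i _ => Finset.sum_nonneg fun j _ => (hM i j).1)
    (by positivity)

theorem two_rpow_neg_le_one {x : ℝ} (hx : 0 ≤ x) : (2 : ℝ) ^ (-x) ≤ 1 :=
  Real.rpow_le_one_of_one_le_of_nonpos one_le_two (by linarith)

theorem two_rpow_neg_le_one_sub {s : ℝ} (hs0 : 0 ≤ s) (hs : s ≤ 1 / 2) :
    (2 : ℝ) ^ (-(10000 * s)) ≤ 1 - s := by
  have hl : (0.6931471803 : ℝ) < Real.log 2 := Real.log_two_gt_d9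
  rw [Real.rpow_def_of_pos two_pos]
  have h1 : Real.exp (Real.log 2 * -(10000 * s)) ≤ Real.exp (-(2 * s)) :=
    Real.exp_le_exp.2 (by nlinarith)
  have h2 : 2 * s + 1 ≤ Real.exp (2 * s) := Real.add_one_le_exp _
  refine h1.trans ?_
  rw [Real.exp_neg, inv_le_iff_one_le_mul₀ (Real.exp_pos _)]
  nlinarith

/-- The zero submatrix theorem, without any logarithmic loss. The density decrement is used when
`√(ε r) ≥ 1/2`, and for smaller values the matrix is already sparse enough. The constant exceeds
`2 * 4608 + 6`, as `k ≤ 4608 √(ε r) + 1` rounds leave at least `3 ^ (-k) / 2` of the rows and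
columns. -/
theorem hasZeroSubmatrix_two_rpow {m n r : ℕ} {M : Matrix (Fin m) (Fin n) ℝ}
    (hM : IsNonnegSeparated M) (hrank : M.rank ≤ r) (hε : avgEntry M ≤ 1 / 2) :
    HasZeroSubmatrix M ((m : ℝ) * (2 : ℝ) ^ (-(10000 * √(avgEntry M * r))))
      ((n : ℝ) * (2 : ℝ) ^ (-(10000 * √(avgEntry M * r)))) := by
  have hM' := hM.eq_zero_or_one_le
  set ε := avgEntry M with hεdef
  set s := √(ε * r) with hs
  have hε0 : 0 ≤ ε := avgEntry_nonneg hM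
  have hs0 : 0 ≤ s := Real.sqrt_nonneg _
  have hpow1 : (2 : ℝ) ^ (-(10000 * s)) ≤ 1 := two_rpow_neg_le_one (by positivity)
  by_cases hzero : ∀ i j, M i j = 0
  · refine ⟨Finset.univ, Finset.univ, ?_, ?_, fun i _ j _ => hzero i j⟩
    · rw [Finset.card_univ, Fintype.card_fin]
      exact mul_le_of_le_one_right (by positivity) hpow1
    · rw [Finset.card_univ, Fintype.card_fin]
      exact mul_le_of_le_one_right (by positivity) hpow1
  push Not at hzero
  obtain ⟨i₀, j₀, hij⟩ := hzero
  have hm : (0 : ℝ) < m := by exact_mod_cast i₀.pos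
  have hn : (0 : ℝ) < n := by exact_mod_cast j₀.pos
  have hr : 0 < r := by
    refine Nat.pos_of_ne_zero fun h => ?_
    rw [h, Nat.le_zero, Matrix.rank_eq_finrank_span_row, Submodule.finrank_eq_zero,
      Submodule.span_eq_bot] at hrank
    exact hij (congrFun (hrank (M.row i₀) ⟨i₀, rfl⟩) j₀)
  have hr' : (0 : ℝ) < r := by exact_mod_cast hr
  have hμsum : ∑ _i : Fin m, (1 : ℝ) = m := by simp
  have hνsum : ∑ _j : Fin n, (1 : ℝ) = n := by simp
  have hws : wsum (fun _ => 1) (fun _ => 1) M = ε * ((∑ _i : Fin m, (1 : ℝ)) * ∑ _j : Fin n, 1) := by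
    rw [hμsum, hνsum, hεdef, avgEntry, div_mul_cancel₀ _ (by positivity)]
    simp [wsum]
  have hεpos : 0 < ε := by
    refine div_pos ?_ (by positivity)
    have h1 : 0 < M i₀ j₀ := (hM i₀ j₀).1.lt_of_ne' hij
    refine Finset.sum_pos' (fun i _ => Finset.sum_nonneg fun j _ => (hM i j).1)
      ⟨i₀, Finset.mem_univ _, ?_⟩
    exact Finset.sum_pos' (fun j _ => (hM i₀ j).1) ⟨j₀, Finset.mem_univ _, h1⟩
  rcases le_total s (1 / 2) with hsmall | hlarge
  · -- With `τ = √(ε / r)` both losses are equal to `s`.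
    have hτ : 0 < √(ε / r) := Real.sqrt_pos.2 (by positivity)
    have hrτ : r * √(ε / r) = s := by
      rw [hs, show ε * r = r ^ 2 * (ε / r) by field_simp, Real.sqrt_mul (by positivity),
        Real.sqrt_sq hr'.le]
    have hετ : ε / √(ε / r) = s := by
      rw [div_eq_iff hτ.ne', ← hrτ, mul_assoc, Real.mul_self_sqrt (by positivity)]
      field_simp
    obtain ⟨R, S, hR, hS, hRS⟩ := exists_zero_submatrix_of_density_le hM' hrank
      (fun _ => zero_le_one) (fun _ => zero_le_one) (by rw [hνsum]; exact hn) hτ hws.le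
    rw [hετ, hμsum, Finset.sum_const, nsmul_eq_mul, mul_one] at hR
    rw [hrτ, hνsum, Finset.sum_const, nsmul_eq_mul, mul_one] at hS
    have h := two_rpow_neg_le_one_sub hs0 hsmall
    refine ⟨R, S, le_trans ?_ hR, le_trans ?_ hS, hRS⟩
    · rw [mul_comm]; exact mul_le_mul_of_nonneg_right h hm.le
    · rw [mul_comm]; exact mul_le_mul_of_nonneg_right h hn.le
  · set k := ⌈(s - 1 / 2) * 4608⌉₊ with hk
    have hk1 : (s - 1 / 2) * 4608 ≤ k := Nat.le_ceil _
    have hk2 : (k : ℝ) < (s - 1 / 2) * 4608 + 1 := Nat.ceil_lt_add_one (by linarith)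
    obtain ⟨μ, ν, hμ, hν, hP, hN, hle⟩ := exists_weights_density_le_inv hM' hr hrank k
      (fun _ => 1) (fun _ => 1) ε (fun _ => zero_le_one) (fun _ => zero_le_one)
      (by rw [hμsum]; exact hm) (by rw [hνsum]; exact hn) hε0 hε hws (by linarith)
    rw [hμsum] at hP
    rw [hνsum] at hN
    have h3k : (0 : ℝ) < 3 ^ k := by positivity
    have hN0 : 0 < ∑ j, ν j := by
      by_contra h
      push Not at h
      nlinarith
    have hτ : (0 : ℝ) < 1 / (2 * r) := by positivity
    obtain ⟨R, S, hR, hS, hRS⟩ := exists_zero_submatrix_of_density_le hM' hrank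
      (fun i => (hμ i).1) (fun j => (hν j).1) hN0 hτ hle
    have e1 : 1 - 1 / (4 * (r : ℝ)) / (1 / (2 * r)) = 1 / 2 := by field_simp; norm_num
    have e2 : 1 - (r : ℝ) * (1 / (2 * r)) = 1 / 2 := by field_simp; norm_num
    rw [e1] at hR
    rw [e2] at hS
    have hRc : ∑ i ∈ R, μ i ≤ R.card := by
      refine (Finset.sum_le_sum fun i _ => (hμ i).2).trans ?_
      simp
    have hSc : ∑ j ∈ S, ν j ≤ S.card := by
      refine (Finset.sum_le_sum fun j _ => (hν j).2).trans ?_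
      simp
    have hpow : (2 : ℝ) ^ (-(10000 * s)) * (2 * 3 ^ k) ≤ 1 := by
      have h1 : (2 : ℝ) * 3 ^ k ≤ 2 ^ (10000 * s) := by
        calc (2 : ℝ) * 3 ^ k ≤ 2 * 4 ^ k := by gcongr; norm_num
          _ = 2 ^ ((2 * k + 1 : ℕ) : ℝ) := by
              rw [Real.rpow_natCast, pow_succ, pow_mul]
              norm_num
              ring
          _ ≤ _ := by
              refine Real.rpow_le_rpow_of_exponent_le one_le_two ?_
              push_cast
              linarith
      rw [Real.rpow_neg zero_le_two, inv_mul_le_iff₀ (by positivity), mul_one]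
      exact h1
    have hpow0 : 0 < (2 : ℝ) ^ (-(10000 * s)) := by positivity
    refine ⟨R, S, ?_, ?_, hRS⟩
    · have hP0 : 0 ≤ ∑ i, μ i := Finset.sum_nonneg fun i _ => (hμ i).1
      calc _ ≤ (3 ^ k * ∑ i, μ i) * (2 : ℝ) ^ (-(10000 * s)) := by gcongr
        _ = ((2 : ℝ) ^ (-(10000 * s)) * (2 * 3 ^ k)) * (1 / 2 * ∑ i, μ i) := by ring
        _ ≤ 1 * (1 / 2 * ∑ i, μ i) := by gcongr
        _ ≤ _ := by linarith
    · calc _ ≤ (3 ^ k * ∑ j, ν j) * (2 : ℝ) ^ (-(10000 * s)) := by gcongr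
        _ = ((2 : ℝ) ^ (-(10000 * s)) * (2 * 3 ^ k)) * (1 / 2 * ∑ j, ν j) := by ring
        _ ≤ 1 * (1 / 2 * ∑ j, ν j) := by gcongr
        _ ≤ _ := by linarith

/-- A matrix with entries in `{0, 1}` or its complement has average at most `1/2`, and the
complement has rank at most one more. -/
theorem hasConstantSubmatrix_two_rpow {m n r : ℕ} {M : Matrix (Fin m) (Fin n) ℝ}
    (hM : ∀ i j, M i j = 0 ∨ M i j = 1) (hrank : M.rank = r) :
    HasConstantSubmatrix M ((m : ℝ) * (2 : ℝ) ^ (-(10000 * √r)))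
      ((n : ℝ) * (2 : ℝ) ^ (-(10000 * √r))) := by
  have hsep : IsNonnegSeparated M := fun i j => by
    rcases hM i j with h | h <;> rw [h] <;> simp
  by_cases hε : avgEntry M ≤ 1 / 2
  · refine ⟨0, (hasZeroSubmatrix_two_rpow hsep hrank.le hε).mono ?_ ?_⟩ <;>
    · gcongr
      · exact one_le_two
      · have : (0 : ℝ) ≤ r := by positivity
        nlinarith
  · push Not at hε
    have hmn : (m : ℝ) * n ≠ 0 := by
      intro h
      rw [avgEntry, h, div_zero] at hε
      linarith
    set M' : Matrix (Fin m) (Fin n) ℝ := fun i j => 1 - M i j with hM'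
    have hsep' : IsNonnegSeparated M' := fun i j => by
      rcases hM i j with h | h <;> simp [hM', h]
    have havg : avgEntry M' = 1 - avgEntry M := by
      rw [avgEntry, avgEntry, eq_sub_iff_add_eq, ← add_div, div_eq_one_iff_eq hmn]
      simp [hM', Finset.sum_sub_distrib]
    have hr : 0 < r := by
      refine Nat.pos_of_ne_zero fun h => ?_
      rw [h, Matrix.rank_eq_finrank_span_row, Submodule.finrank_eq_zero,
        Submodule.span_eq_bot] at hrank
      have hz : ∀ i j, M i j = 0 := fun i j => congrFun (hrank (M.row i) ⟨i, rfl⟩) j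
      simp only [avgEntry, hz, Finset.sum_const_zero, zero_div] at hε
      linarith
    have hrank' : M'.rank ≤ 2 * r := by
      have h1 : M'.rank ≤ r + 1 := by
        rw [Matrix.rank_eq_finrank_span_row]
        have hle : Submodule.span ℝ (Set.range M'.row)
            ≤ Submodule.span ℝ (Set.range M.row) ⊔ Submodule.span ℝ {1} := by
          rw [Submodule.span_le]
          rintro _ ⟨i, rfl⟩
          have h1 := Submodule.mem_sup_left (T := Submodule.span ℝ {(1 : Fin n → ℝ)})
            (Submodule.subset_span (R := ℝ) (s := Set.range M.row) ⟨i, rfl⟩)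
          have h2 := Submodule.mem_sup_right (S := Submodule.span ℝ (Set.range M.row))
            (Submodule.mem_span_singleton_self (R := ℝ) (1 : Fin n → ℝ))
          exact Submodule.sub_mem _ h2 h1
        refine (Submodule.finrank_mono hle).trans
          ((Submodule.finrank_add_le_finrank_add_finrank _ _).trans (add_le_add ?_ ?_))
        · rw [← Matrix.rank_eq_finrank_span_row, hrank]
        · exact (finrank_span_le_card _).trans (by simp)
      omega
    obtain ⟨R, S, hR, hS, hRS⟩ := hasZeroSubmatrix_two_rpow hsep' hrank' (by rw [havg]; linarith)
    have hle : avgEntry M' * ((2 * r : ℕ) : ℝ) ≤ r := by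
      have : (0 : ℝ) ≤ r := by positivity
      rw [havg]
      push_cast
      nlinarith
    refine ⟨1, R, S, le_trans ?_ hR, le_trans ?_ hS,
      fun i hi j hj => (sub_eq_zero.1 (hRS i hi j hj)).symm⟩ <;>
    · gcongr
      · exact one_le_two

/-! ### Matrices counting coordinate agreements -/

section Agreement

variable {t : ℕ} (K : Fin t → ℕ) (q : ℕ)

/-- The index set of the extremal matrices: words whose `i`-th letter ranges over an alphabet of
`K i + 1` letters, each repeated `q` times. -/
abbrev Word : Type := ((i : Fin t) → Fin (K i + 1)) × Fin q

/-- The matrix whose `(x, y)` entry is the number of coordinates in which the words `x` and `y`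
agree. -/
def agreeMatrix : Matrix (Word K q) (Word K q) ℝ :=
  fun x y => ∑ i, if x.1 i = y.1 i then 1 else 0

/-- The rows of this matrix are the indicators of the events "the `i`-th letter is `a`". -/
def letterMatrix : Matrix (Σ i, Fin (K i + 1)) (Word K q) ℝ :=
  fun p x => if x.1 p.1 = p.2 then 1 else 0

/-- A basis of the row space of `letterMatrix K q`: the constant function, and the indicators of the
nonzero letters. -/
def letterBasis : Matrix (Option (Σ i, Fin (K i))) (Word K q) ℝ
  | none, _ => 1
  | some p, x => if x.1 p.1 = p.2.succ then 1 else 0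

theorem agreeMatrix_eq_mul :
    agreeMatrix K q = (letterMatrix K q).transpose * letterMatrix K q := by
  ext x y
  simp only [agreeMatrix, letterMatrix, Matrix.mul_apply, Matrix.transpose_apply,
    Fintype.sum_sigma]
  refine Finset.sum_congr rfl fun i _ => ?_
  simp [eq_comm]

theorem linearIndependent_letterBasis (hq : 0 < q) :
    LinearIndependent ℝ (letterBasis K q).row := by
  classical
  rw [Fintype.linearIndependent_iff]
  intro g hg
  have hval : ∀ x : Word K q,
      g none + ∑ p : Σ i, Fin (K i), g (some p) * (if x.1 p.1 = p.2.succ then 1 else 0) = 0 := by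
    intro x
    have := congrFun hg x
    rw [Fintype.sum_option] at this
    simpa [letterBasis, Matrix.row] using this
  have hnone : g none = 0 := by
    have := hval (0, ⟨0, hq⟩)
    simpa [(Fin.succ_ne_zero _).symm] using this
  rintro (_ | ⟨i, a⟩)
  · exact hnone
  · -- Evaluate at the word whose only nonzero letter is the `i`-th.
    have h := hval (Function.update 0 i a.succ, ⟨0, hq⟩)
    rw [hnone, zero_add, Finset.sum_eq_single ⟨i, a⟩] at h
    · simpa using h
    · rintro ⟨j, b⟩ _ hne
      rcases eq_or_ne j i with rfl | hji
      · have : a ≠ b := fun hab => hne (by rw [hab])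
        simp [this]
      · simp [Function.update_of_ne hji, (Fin.succ_ne_zero _).symm]
    · simp

theorem span_letterMatrix (ht : 0 < t) :
    Submodule.span ℝ (Set.range (letterMatrix K q).row)
      = Submodule.span ℝ (Set.range (letterBasis K q).row) := by
  -- The indicators of the letters in one coordinate add up to the constant function.
  have hsum : ∀ i : Fin t, ∑ a, (letterMatrix K q).row ⟨i, a⟩ = (letterBasis K q).row none := by
    intro i
    ext x
    simp [letterMatrix, letterBasis, Matrix.row]
  have hsucc : ∀ (i : Fin t) (a : Fin (K i)),
      (letterMatrix K q).row ⟨i, a.succ⟩ = (letterBasis K q).row (some ⟨i, a⟩) := fun i a => rfl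
  refine le_antisymm (Submodule.span_le.2 ?_) (Submodule.span_le.2 ?_)
  · have hmem : ∀ o, (letterBasis K q).row o
        ∈ Submodule.span ℝ (Set.range (letterBasis K q).row) :=
      fun o => Submodule.subset_span ⟨o, rfl⟩
    rintro _ ⟨⟨i, a⟩, rfl⟩
    refine Fin.cases ?_ (fun b => ?_) a
    · have h := hsum i
      rw [Fin.sum_univ_succ] at h
      rw [SetLike.mem_coe, eq_sub_of_add_eq h]
      refine Submodule.sub_mem _ (hmem none) (Submodule.sum_mem _ fun b _ => ?_)
      rw [hsucc]
      exact hmem _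
    · rw [hsucc]
      exact hmem _
  · rintro _ ⟨_ | ⟨i, a⟩, rfl⟩
    · rw [← hsum ⟨0, ht⟩]
      exact Submodule.sum_mem _ fun a _ => Submodule.subset_span ⟨_, rfl⟩
    · rw [← hsucc]
      exact Submodule.subset_span ⟨_, rfl⟩

theorem rank_agreeMatrix (ht : 0 < t) (hq : 0 < q) :
    (agreeMatrix K q).rank = ∑ i, K i + 1 := by
  rw [agreeMatrix_eq_mul, Matrix.rank_transpose_mul_self, Matrix.rank_eq_finrank_span_row,
    span_letterMatrix K q ht, ← Matrix.rank_eq_finrank_span_row,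
    (linearIndependent_letterBasis K q hq).rank_matrix]
  simp

theorem card_word : Fintype.card (Word K q) = (∏ i, (K i + 1)) * q := by
  simp

theorem sum_letter_eq (i : Fin t) (a : Fin (K i + 1)) :
    (∑ x : Word K q, if a = x.1 i then (1 : ℝ) else 0) * (K i + 1) = Fintype.card (Word K q) := by
  have h1 : (∑ x : Word K q, if a = x.1 i then (1 : ℝ) else 0)
      = (∑ z : (j : Fin t) → Fin (K j + 1), if a = z i then (1 : ℝ) else 0) * q := by
    rw [Fintype.sum_prod_type, Finset.sum_mul]
    refine Finset.sum_congr rfl fun z _ => ?_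
    split_ifs <;> simp
  have h2 : (∑ z : (j : Fin t) → Fin (K j + 1), if a = z i then (1 : ℝ) else 0)
      = Fintype.card ((j : {j // j ≠ i}) → Fin (K j + 1)) := by
    rw [← (Equiv.piSplitAt i fun j => Fin (K j + 1)).symm.sum_comp, Fintype.sum_prod_type]
    simp [Equiv.piSplitAt]
  have h3 : Fintype.card ((j : Fin t) → Fin (K j + 1))
      = (K i + 1) * Fintype.card ((j : {j // j ≠ i}) → Fin (K j + 1)) := by
    rw [Fintype.card_congr (Equiv.piSplitAt i fun j => Fin (K j + 1)), Fintype.card_prod,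
      Fintype.card_fin]
  rw [h1, h2, Fintype.card_prod, h3, Fintype.card_fin]
  push_cast
  ring

theorem sum_agreeMatrix :
    ∑ x, ∑ y, agreeMatrix K q x y
      = (∑ i, 1 / ((K i : ℝ) + 1)) * (Fintype.card (Word K q) : ℝ) ^ 2 := by
  have h : ∀ x : Word K q, ∑ y, agreeMatrix K q x y
      = (∑ i, 1 / ((K i : ℝ) + 1)) * Fintype.card (Word K q) := by
    intro x
    simp only [agreeMatrix]
    rw [Finset.sum_comm, Finset.sum_mul]
    refine Finset.sum_congr rfl fun i _ => ?_
    rw [← sum_letter_eq K q i (x.1 i)]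
    field_simp
  simp only [h, Finset.sum_const, Finset.card_univ, nsmul_eq_mul]
  ring

/-- In an all-zero submatrix, the rows and the columns use disjoint sets of letters in every
coordinate. -/
theorem four_pow_mul_card_mul_card_le {R S : Finset (Word K q)}
    (h : ∀ x ∈ R, ∀ y ∈ S, ∀ i, x.1 i ≠ y.1 i) :
    4 ^ t * (R.card * S.card) ≤ Fintype.card (Word K q) ^ 2 := by
  classical
  have hcard : ∀ T : Finset (Word K q), T.card ≤ (∏ i, (T.image fun x => x.1 i).card) * q := by
    intro T
    have hsub : T ⊆ (Fintype.piFinset fun i => T.image fun x => x.1 i) ×ˢ Finset.univ := by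
      intro x hx
      simp only [Finset.mem_product, Fintype.mem_piFinset, Finset.mem_univ, and_true]
      exact fun i => Finset.mem_image_of_mem _ hx
    refine (Finset.card_le_card hsub).trans ?_
    simp [Finset.card_product, Fintype.card_piFinset]
  have hdisj : ∀ i, 4 * ((R.image fun x => x.1 i).card * (S.image fun x => x.1 i).card)
      ≤ (K i + 1) ^ 2 := by
    intro i
    have hd : Disjoint (R.image fun x => x.1 i) (S.image fun x => x.1 i) := by
      rw [Finset.disjoint_left]
      intro a ha hb
      obtain ⟨x, hx, rfl⟩ := Finset.mem_image.1 ha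
      obtain ⟨y, hy, hxy⟩ := Finset.mem_image.1 hb
      exact h x hx y hy i hxy.symm
    have h1 := Finset.card_le_univ ((R.image fun x => x.1 i) ∪ S.image fun x => x.1 i)
    rw [Finset.card_union_of_disjoint hd, Fintype.card_fin] at h1
    have h2 := Nat.pow_le_pow_left h1 2
    refine le_trans ?_ h2
    rw [← mul_assoc]
    exact four_mul_le_sq_add _ _
  calc 4 ^ t * (R.card * S.card)
      ≤ 4 ^ t * (((∏ i, (R.image fun x => x.1 i).card) * q)
          * ((∏ i, (S.image fun x => x.1 i).card) * q)) := by
        gcongr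
        · exact hcard R
        · exact hcard S
    _ = (∏ i, (4 * ((R.image fun x => x.1 i).card * (S.image fun x => x.1 i).card))) * q ^ 2 := by
        rw [Finset.prod_mul_distrib, Finset.prod_mul_distrib]
        simp
        ring
    _ ≤ (∏ i, (K i + 1) ^ 2) * q ^ 2 := by
        gcongr with i
        exact hdisj i
    _ = _ := by rw [card_word, Finset.prod_pow, mul_pow]

end Agreement

/-- A scaled agreement matrix, as a matrix indexed by `Fin n`. -/
theorem exists_agreement_matrix {t : ℕ} (ht : 0 < t) (K : Fin t → ℕ) {ε : ℝ}
    (hε : ∑ i, 1 / ((K i : ℝ) + 1) ≤ ε) (N : ℕ) :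
    ∃ n : ℕ, N ≤ n ∧ ∃ M : Matrix (Fin n) (Fin n) ℝ,
      IsNonnegSeparated M ∧ M.rank = ∑ i, K i + 1 ∧ avgEntry M = ε ∧
        ∀ a : ℝ, HasZeroSubmatrix M a a → a ≤ (n : ℝ) / (2 : ℝ) ^ t := by
  have hne : (Finset.univ : Finset (Fin t)).Nonempty := ⟨⟨0, ht⟩, Finset.mem_univ _⟩
  set σ := ∑ i, 1 / ((K i : ℝ) + 1) with hσ
  have hσ0 : 0 < σ := Finset.sum_pos (fun i _ => by positivity) hne
  have hs1 : 1 ≤ ε / σ := (one_le_div hσ0).2 hε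
  have hs0 : 0 < ε / σ := one_pos.trans_le hs1
  let e := Fintype.equivFin (Word K (N + 1))
  have hcard : N + 1 ≤ Fintype.card (Word K (N + 1)) := by
    rw [card_word]
    exact Nat.le_mul_of_pos_left _ (Finset.prod_pos fun i _ => Nat.succ_pos _)
  have hn0 : (0 : ℝ) < Fintype.card (Word K (N + 1)) := by
    have : 0 < Fintype.card (Word K (N + 1)) := by omega
    exact_mod_cast this
  refine ⟨Fintype.card (Word K (N + 1)), by omega,
    ((ε / σ) • agreeMatrix K (N + 1)).submatrix e.symm e.symm, fun i j => ?_, ?_, ?_, ?_⟩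
  · have hnat : ∃ c : ℕ, agreeMatrix K (N + 1) (e.symm i) (e.symm j) = c :=
      ⟨∑ l, if (e.symm i).1 l = (e.symm j).1 l then 1 else 0, by simp [agreeMatrix]⟩
    obtain ⟨c, hc⟩ := hnat
    simp only [Matrix.submatrix_apply, Matrix.smul_apply, hc, smul_eq_mul]
    refine ⟨by positivity, fun h => ?_⟩
    rcases Nat.eq_zero_or_pos c with h0 | h0
    · rw [h0, Nat.cast_zero, mul_zero] at h
      exact lt_irrefl _ h.1
    · have h1 : (1 : ℝ) ≤ c := by exact_mod_cast h0
      nlinarith [h.2]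
  · rw [Matrix.rank_submatrix, Matrix.rank_smul_of_mem_nonZeroDivisors _
      (mem_nonZeroDivisors_of_ne_zero hs0.ne'), rank_agreeMatrix K _ ht (Nat.succ_pos N)]
  · have hsum : ∑ i, ∑ j, ((ε / σ) • agreeMatrix K (N + 1)).submatrix e.symm e.symm i j
        = ε / σ * ∑ x, ∑ y, agreeMatrix K (N + 1) x y := by
      rw [Finset.mul_sum, ← e.symm.sum_comp]
      refine Finset.sum_congr rfl fun i _ => ?_
      rw [Finset.mul_sum, ← e.symm.sum_comp]
      rfl
    rw [avgEntry, hsum]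
    rw [sum_agreeMatrix, ← hσ]
    field_simp
  · rintro a ⟨R, S, hR, hS, hRS⟩
    rcases le_total a 0 with ha | ha
    · exact ha.trans (by positivity)
    have hz : ∀ x ∈ R.map e.symm.toEmbedding, ∀ y ∈ S.map e.symm.toEmbedding,
        ∀ i, x.1 i ≠ y.1 i := by
      intro x hx y hy i hxy
      obtain ⟨k, hk, rfl⟩ := Finset.mem_map.1 hx
      obtain ⟨l, hl, rfl⟩ := Finset.mem_map.1 hy
      have h0 := hRS k hk l hl
      simp only [Matrix.submatrix_apply, Matrix.smul_apply, smul_eq_mul, mul_eq_zero, hs0.ne',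
        false_or, agreeMatrix] at h0
      rw [Finset.sum_eq_zero_iff_of_nonneg (fun i _ => by split_ifs <;> norm_num)] at h0
      have := h0 i (Finset.mem_univ i)
      rw [if_pos (show (e.symm k).1 i = (e.symm l).1 i from hxy)] at this
      exact one_ne_zero this
    have h4 := four_pow_mul_card_mul_card_le K (N + 1) hz
    rw [Finset.card_map, Finset.card_map] at h4
    have h4' : (4 : ℝ) ^ t * (R.card * S.card) ≤ (Fintype.card (Word K (N + 1)) : ℝ) ^ 2 := by
      exact_mod_cast h4
    rw [le_div_iff₀ (by positivity)]
    refine le_of_sq_le_sq ?_ hn0.le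
    refine le_trans ?_ h4'
    calc (a * 2 ^ t) ^ 2 = 4 ^ t * (a * a) := by
          rw [mul_pow, ← pow_mul, mul_comm t 2, pow_mul]
          norm_num
          ring
      _ ≤ _ := by gcongr

/-- The parameters of the extremal matrix: `t = ⌊√(ε r)⌋` coordinates, with alphabets of size
`⌈t / ε⌉`, one of them enlarged so that the rank is exactly `r`. -/
theorem exists_extremal_matrix {r : ℕ} {ε : ℝ} (hr : 0 < r) (hε : 1 / (r : ℝ) ≤ ε) (N : ℕ) :
    ∃ n : ℕ, N ≤ n ∧ ∃ M : Matrix (Fin n) (Fin n) ℝ,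
      IsNonnegSeparated M ∧ M.rank = r ∧ avgEntry M = ε ∧
        ∀ a : ℝ, HasZeroSubmatrix M a a → a ≤ (n : ℝ) / (2 : ℝ) ^ ⌊√(ε * r)⌋₊ := by
  have hr' : (0 : ℝ) < r := by exact_mod_cast hr
  have hε0 : 0 < ε := lt_of_lt_of_le (by positivity) hε
  set t := ⌊√(ε * r)⌋₊ with htdef
  have hεr : 1 ≤ ε * r := (div_le_iff₀ hr').1 hε
  have ht : 0 < t := Nat.floor_pos.2 (Real.one_le_sqrt.2 hεr)
  have ht' : (0 : ℝ) < t := by exact_mod_cast ht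
  have ht2 : (t : ℝ) ^ 2 ≤ ε * r := by
    have h1 : (t : ℝ) ≤ √(ε * r) := Nat.floor_le (Real.sqrt_nonneg _)
    calc (t : ℝ) ^ 2 ≤ √(ε * r) ^ 2 := by gcongr
      _ = _ := Real.sq_sqrt (by positivity)
  obtain ⟨k, hk⟩ : ∃ k, ⌈t / ε⌉₊ = k + 1 :=
    Nat.exists_eq_succ_of_ne_zero (Nat.ceil_pos.2 (by positivity)).ne'
  have hk1 : t / ε ≤ k + 1 := by
    have := Nat.le_ceil (t / ε)
    rw [hk] at this
    exact_mod_cast this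
  have hk2 : (k : ℝ) < t / ε := by
    have := Nat.ceil_lt_add_one (show 0 ≤ t / ε by positivity)
    rw [hk] at this
    push_cast at this
    linarith
  have htk : t * k + 1 ≤ r := by
    have h1 : (t : ℝ) * k < r := by
      rw [lt_div_iff₀ hε0] at hk2
      have h2 : (t : ℝ) * k * ε < r * ε := by nlinarith
      exact lt_of_mul_lt_mul_right h2 hε0.le
    exact_mod_cast h1
  obtain ⟨c, hc⟩ := Nat.exists_eq_add_of_le htk
  set K : Fin t → ℕ := fun i => k + if i = ⟨0, ht⟩ then c else 0 with hK
  have hsum : ∑ i, K i + 1 = r := by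
    simp only [hK, Finset.sum_add_distrib, Finset.sum_const, Finset.card_univ, Fintype.card_fin,
      smul_eq_mul, Finset.sum_ite_eq', Finset.mem_univ, if_true]
    omega
  have hle : ∑ i, 1 / ((K i : ℝ) + 1) ≤ ε := by
    have h1 : ∀ i, 1 / ((K i : ℝ) + 1) ≤ 1 / ((k : ℝ) + 1) := by
      intro i
      have : (k : ℝ) ≤ K i := by exact_mod_cast Nat.le_add_right _ _
      gcongr
    calc _ ≤ ∑ _i : Fin t, 1 / ((k : ℝ) + 1) := Finset.sum_le_sum fun i _ => h1 i
      _ = t / ((k : ℝ) + 1) := by simp [div_eq_mul_inv]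
      _ ≤ ε := by
        rw [div_le_iff₀ hε0] at hk1
        rw [div_le_iff₀ (by positivity)]
        linarith
  have := exists_agreement_matrix ht K hle N
  rwa [hsum] at this

/-! ### The bounds and their optimality -/

theorem mainTheorem9 :
    -- the bound
    (∃ C : ℝ, 0 < C ∧ ∀ (m n r : ℕ) (ε : ℝ) (M : Matrix (Fin m) (Fin n) ℝ),
      IsNonnegSeparated M → M.rank = r → avgEntry M = ε → ε ≤ 1 / 2 →
        HasZeroSubmatrix M
          ((m : ℝ) * (2 : ℝ) ^ (-(C * (Real.log r + Real.sqrt (ε * r)))))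
          ((n : ℝ) * (2 : ℝ) ^ (-(C * (Real.log r + Real.sqrt (ε * r)))))) ∧
    -- in the regime where `ε` is at least of order `(log r)^2 / r`,
    -- the exponent is of order at most `√(ε r)`
    (∀ κ : ℝ, 0 < κ → ∃ C : ℝ, 0 < C ∧
      ∀ (m n r : ℕ) (ε : ℝ) (M : Matrix (Fin m) (Fin n) ℝ),
        IsNonnegSeparated M → M.rank = r → avgEntry M = ε → ε ≤ 1 / 2 →
        κ * (Real.log r) ^ 2 / r ≤ ε →
          HasZeroSubmatrix M
            ((m : ℝ) * (2 : ℝ) ^ (-(C * Real.sqrt (ε * r))))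
            ((n : ℝ) * (2 : ℝ) ^ (-(C * Real.sqrt (ε * r))))) ∧
    -- and this order cannot be improved
    (∀ (r : ℕ) (ε : ℝ), 0 < r → 1 / (r : ℝ) ≤ ε → ε ≤ 1 / 2 →
      ∀ N : ℕ, ∃ n : ℕ, N ≤ n ∧ ∃ M : Matrix (Fin n) (Fin n) ℝ,
        IsNonnegSeparated M ∧ M.rank = r ∧ avgEntry M = ε ∧
          ∀ a : ℝ, HasZeroSubmatrix M a a →
            a ≤ (n : ℝ) / (2 : ℝ) ^ ⌊Real.sqrt (ε * r)⌋₊) ∧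
    -- the log-rank bound for binary matrices
    (∃ C : ℝ, 0 < C ∧ ∀ (m n r : ℕ) (M : Matrix (Fin m) (Fin n) ℝ),
      (∀ i j, M i j = 0 ∨ M i j = 1) → M.rank = r →
        HasConstantSubmatrix M
          ((m : ℝ) * (2 : ℝ) ^ (-(C * Real.sqrt r)))
          ((n : ℝ) * (2 : ℝ) ^ (-(C * Real.sqrt r)))) := by
  refine ⟨⟨10000, by norm_num, ?_⟩, fun κ hκ => ⟨10000, by norm_num, ?_⟩,
    fun r ε hr hε _ N => exists_extremal_matrix hr hε N, ⟨10000, by norm_num, ?_⟩⟩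
  · rintro m n r ε M hM hrank rfl hε
    refine (hasZeroSubmatrix_two_rpow hM hrank.le hε).of_exponent_le ?_
    have : 0 ≤ Real.log r := Real.log_natCast_nonneg r
    linarith
  · rintro m n r ε M hM hrank rfl hε _
    exact hasZeroSubmatrix_two_rpow hM hrank.le hε
  · exact fun m n r M hM hrank => hasConstantSubmatrix_two_rpow hM hrank
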